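/- **Setting.** Let $\mathcal A$ be a finite set of agents that are the nodes of a connected undirected graph $\mathcal G$ with diameter $d(\mathcal G)$; write $\mathcal N_i$ for the neighbours of $i$. Let $\mathcal P$ be a finite set with $n=|\mathcal P|$, partitioned into the strategy sets $\mathcal P_i$, $i\in\mathcal A$. Let $1\le\kappa_i\le|\mathcal P_i|$ be integers and $\kappa=\sum_{i}\kappa_i$. Call $\mathcal R\subseteq\mathcal P$ admissible if $|\mathcal R\cap\mathcal P_i|\le\kappa_i$ for all $i$. Let $f:2^{\mathcal P}\to\mathbb R_{\ge0}$ be normalized ($f(\emptyset)=0$), monotone increasing and submodular, and let $\mathcal R^\star$ maximize $f$ over the admissible sets. With $\Delta_f(p\mid\mathcal S)=f(\mathcal S\cup\{p\})-f(\mathcal S)$, let $$c=1-\min_{\mathcal S,\ p\notin\mathcal S}\frac{\Delta_f(p\mid\mathcal S)}{\Delta_f(p\mid\emptyset)}$$ be the total curvature of $f$, the minimum being over pairs with $\Delta_f(p\mid\emptyset)\ne0$ ($c=0$ if there are none). Let $T\ge1$ and $K_i\ge1$ ($i\in\mathcal A$) be integers and $\underline K=\min_iK_i$. **Sampling phase.**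 Every agent $i$ holds a vector $x_i(t)\in[0,1]^{\mathcal P}$ with $x_i(0)=0$. At each iteration $t=0,\dots,T-1$: 1. Each agent $i$ draws, independently of everything else given the current vectors, $K_i$ independent random sets $\mathcal R_i^1,\dots,\mathcal R_i^{K_i}\subseteq\mathcal P$, each containing every $q\in\mathcal P$ independently with probability $[x_i(t)]_q$, and computes, for $p\in\mathcal P_i$, $$w^i_p=\frac1{K_i}\sum_{k=1}^{K_i}\big(f(\mathcal R_i^k\cup\{p\})-f(\mathcal R_i^k\setminus\{p\})\big).$$ 2. It selects $\kappa_i$ elements of $\mathcal P_i$ with the largest weights $w^i_p$ and forms $x_i^-(t+1)$ from $x_i(t)$ by adding $1/T$ to the entries of the selected elements. Ties are broken by an arbitrary rule, which may use $t$, $i$, $x_i(t)$, the computed weights and independent randomness. 3. All agents set $x_i(t+1)=\max_{j\in\mathcal N_i\cup\{i\}}x_j^-(t+1)$ element-wise. **Rounding phase.** Independently of the others, each agent $i$ starts from $y=x_i(T)$ and performs $|\mathcal P_i|$ steps. In a step, if there are two distinct $p,q\in\mathcal P_i$ with $y_p,y_q\in(0,1)$, it picks some such pair (by an arbitrary rule,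 which may use the step, $i$, $y$ and independent randomness). It puts $\delta_p=\min(y_p,1-y_q)$ and $\delta_q=\min(1-y_p,y_q)$, and replaces $(y_p,y_q)$ by $(y_p-\delta_p,\,y_q+\delta_p)$ with probability $\frac{\delta_q}{\delta_p+\delta_q}$ and by $(y_p+\delta_q,\,y_q-\delta_q)$ with probability $\frac{\delta_p}{\delta_p+\delta_q}$; if there is no such pair, $y$ is unchanged. Finally $\bar{\mathcal R}_i=\{p\in\mathcal P_i: y_p=1\}$, and the output is $\bar{\mathcal R}=\bigcup_i\bar{\mathcal R}_i$. **Theorem.** Every output $\bar{\mathcal R}$ that occurs with positive probability is admissible. Moreover, with probability at least $$1-2Tn\,e^{-\underline K/(8T^2)}$$ over the sampling phase, the vectors $(x_i(T))_{i\in\mathcal A}$ are such that $$\mathbb E[f(\bar{\mathcal R})]\ \ge\ \frac1c\,(1-e^{-c})\Big(1-\Big(2c\,\kappa\, d(\mathcal G)+\frac{c\,\kappa}{2}+1\Big)\frac{\kappa}{T}\Big)f(\mathcal R^\star),$$ where $\mathbb E$ is the expectation over the rounding phase given these vectors, and $\frac1c(1-e^{-c})$ is read as its limit $1$ if $c=0$.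 -/

import Mathlib

open scoped ENNReal

namespace DistSubmod

noncomputable section

/-! ### Set functions -/

/-- The marginal gain of adding the strategy `p` to the set `S`. -/
def marginal {P : Type*} [DecidableEq P] (f : Finset P → ℝ) (p : P) (S : Finset P) : ℝ :=
  f (insert p S) - f S

/-- Normalized: the empty set has value zero. -/
def Normalized {P : Type*} (f : Finset P → ℝ) : Prop := f ∅ = 0

/-- Submodular: diminishing marginal gains. -/
def Submodular {P : Type*} [DecidableEq P] (f : Finset P → ℝ) : Prop :=
  ∀ S₁ S₂ : Finset P, S₁ ⊆ S₂ → ∀ p, p ∉ S₂ → marginal f p S₂ ≤ marginal f p S₁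

/-- The pairs `(S, p)` with `p ∉ S` over which the minimum in the total curvature is taken;
the ratio makes sense only when the gain of `p` over the empty set is nonzero. -/
def curvaturePairs {P : Type*} [Fintype P] [DecidableEq P] (f : Finset P → ℝ) :
    Finset (Finset P × P) :=
  Finset.univ.filter fun a => a.2 ∉ a.1 ∧ marginal f a.2 ∅ ≠ 0

/-- The total curvature `c = 1 - min_{S, p ∉ S} Δ(p | S) / Δ(p | ∅)`; it is `0` when there is
no pair to minimize over (for a normalized monotone submodular function: when it vanishes). -/
def curvature {P : Type*} [Fintype P] [DecidableEq P] (f : Finset P → ℝ) : ℝ :=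
  if h : (curvaturePairs f).Nonempty then
    1 - (curvaturePairs f).inf' h fun a => marginal f a.2 a.1 / marginal f a.2 ∅
  else 0

/-- The factor `(1 - e^{-c}) / c`, with its limit value `1` at `c = 0`. -/
def curvatureFactor (c : ℝ) : ℝ := if c = 0 then 1 else 1 / c * (1 - Real.exp (-c))

/-- The sets that contain at most `κ i` strategies of every agent `i`. -/
def Admissible {A P : Type*} [DecidableEq P] (strat : A → Finset P) (κ : A → ℕ)
    (R : Finset P) : Prop :=
  ∀ i, (R ∩ strat i).card ≤ κ i

/-- `R` maximizes `f` over the admissible sets. -/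
def IsOptimal {A P : Type*} [DecidableEq P] (f : Finset P → ℝ) (strat : A → Finset P)
    (κ : A → ℕ) (R : Finset P) : Prop :=
  Admissible strat κ R ∧ ∀ S, Admissible strat κ S → f S ≤ f R

/-! ### Finite probability -/

/-- The joint law of independent variables with the laws `μ i`. -/
def indep {ι : Type*} [Fintype ι] [DecidableEq ι] {α : ι → Type*} [∀ i, Fintype (α i)]
    (μ : ∀ i, PMF (α i)) : PMF (∀ i, α i) :=
  PMF.ofFintype (fun ω => ∏ i, μ i (ω i)) (by
    rw [← Fintype.prod_sum]
    refine Finset.prod_eq_one fun i _ => ?_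
    have h := (μ i).tsum_coe
    rwa [tsum_fintype] at h)

/-- A coin that shows `true` with probability `r`. The algorithm only uses `r ∈ [0, 1]`; other
reals are truncated to that interval. -/
def coin (r : ℝ) : PMF Bool :=
  PMF.ofFintype
    (fun b => cond b (ENNReal.ofReal (max 0 (min 1 r))) (ENNReal.ofReal (1 - max 0 (min 1 r))))
    (by
      have h0 : 0 ≤ max 0 (min 1 r) := le_max_left _ _
      have h1 : max 0 (min 1 r) ≤ 1 := max_le zero_le_one (min_le_left _ _)
      simp only [Fintype.sum_bool, cond_true, cond_false]
      rw [← ENNReal.ofReal_add h0 (sub_nonneg.2 h1)]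
      simp)

/-- The random set that contains every `p` independently with probability `x p`. -/
def randomSet {P : Type*} [Fintype P] [DecidableEq P] (x : P → ℝ) : PMF (Finset P) :=
  (indep fun p => coin (x p)).map fun b => Finset.univ.filter fun p => b p = true

/-- The expectation of `f` at a random set with law `ρ`. -/
def expect {P : Type*} [Fintype P] (ρ : PMF (Finset P)) (f : Finset P → ℝ) : ℝ :=
  ∑ R, (ρ R).toReal * f R

/-! ### Sampled gradients, selection and max-consensus

The information set of an agent (the pairs `(p, α)` it stores) is encoded by the vector of
membership probabilities `P → ℝ`: the value at `p` is `α` if `(p, α)` is stored, and `0` if `p`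
is not stored. A state assigns such a vector to every agent. -/

/-- The empirical gradient entry at `p`, from the `k` sampled sets `R`. -/
def gradientEstimate {P : Type*} [DecidableEq P] (f : Finset P → ℝ) {k : ℕ}
    (R : Fin k → Finset P) (p : P) : ℝ :=
  (∑ l, (f (R l ∪ {p}) - f (R l \ {p}))) / k

/-- `S` consists of `k` elements of `Q` with the largest weights. -/
def IsTopSet {P : Type*} (Q : Finset P) (w : P → ℝ) (k : ℕ) (S : Finset P) : Prop :=
  S ⊆ Q ∧ S.card = k ∧ ∀ p ∈ S, ∀ q ∈ Q, q ∉ S → w q ≤ w p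

/-- A rule by which agent `i`, at iteration `t`, with information `x` and estimated weights `w`,
selects `κ i` of its strategies with the largest weights. Ties are broken arbitrarily, possibly at
random. -/
def IsSelectionRule {A P : Type*} (strat : A → Finset P) (κ : A → ℕ)
    (sel : ℕ → A → (P → ℝ) → (P → ℝ) → PMF (Finset P)) : Prop :=
  ∀ t i x w, ∀ S ∈ (sel t i x w).support, IsTopSet (strat i) w (κ i) S

/-- Propagation: the probabilities of the selected strategies increase by `1 / T`. -/
def propagate {P : Type*} [DecidableEq P] (T : ℕ) (x : P → ℝ) (S : Finset P) : P → ℝ :=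
  fun p => x p + if p ∈ S then 1 / (T : ℝ) else 0

open Classical in
/-- The agent `i` together with its neighbours. -/
def closedNeighbors {A : Type*} [Fintype A] (G : SimpleGraph A) (i : A) : Finset A :=
  Finset.univ.filter fun j => j = i ∨ G.Adj i j

theorem closedNeighbors_nonempty {A : Type*} [Fintype A] (G : SimpleGraph A) (i : A) :
    (closedNeighbors G i).Nonempty :=
  ⟨i, by simp [closedNeighbors]⟩

/-- Update: element-wise maximum over the agent itself and its neighbours. -/
def maxConsensus {A P : Type*} [Fintype A] (G : SimpleGraph A) (x : A → P → ℝ) : A → P → ℝ :=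
  fun i p => (closedNeighbors G i).sup' (closedNeighbors_nonempty G i) fun j => x j p

/-- One iteration: every agent `i` draws `K i` samples according to its own vector, selects
strategies from the estimated weights and propagates; then all agents update. -/
def iteration {A P : Type*} [Fintype A] [DecidableEq A] [Fintype P] [DecidableEq P]
    (G : SimpleGraph A) (f : Finset P → ℝ) (K : A → ℕ) (T : ℕ)
    (sel : ℕ → A → (P → ℝ) → (P → ℝ) → PMF (Finset P)) (t : ℕ) (x : A → P → ℝ) :
    PMF (A → P → ℝ) :=
  (indep fun i => indep fun _ : Fin (K i) => randomSet (x i)).bind fun R =>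
    (indep fun i => sel t i (x i) (gradientEstimate f (R i))).map fun S =>
      maxConsensus G fun i => propagate T (x i) (S i)

/-- The law of the state after `t` iterations from the zero state (empty information sets). -/
def stateAfter {A P : Type*} [Fintype A] [DecidableEq A] [Fintype P] [DecidableEq P]
    (G : SimpleGraph A) (f : Finset P → ℝ) (K : A → ℕ) (T : ℕ)
    (sel : ℕ → A → (P → ℝ) → (P → ℝ) → PMF (Finset P)) : ℕ → PMF (A → P → ℝ)
  | 0 => PMF.pure fun _ _ => 0
  | t + 1 => (stateAfter G f K T sel t).bind (iteration G f K T sel t)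

/-! ### Distributed stochastic Pipage rounding -/

/-- The two distinct strategies in `Q` have membership probabilities strictly between
`0` and `1`. -/
def IsFractionalPair {P : Type*} (Q : Finset P) (y : P → ℝ) (a : P × P) : Prop :=
  a.1 ∈ Q ∧ a.2 ∈ Q ∧ a.1 ≠ a.2 ∧ y a.1 ∈ Set.Ioo (0 : ℝ) 1 ∧ y a.2 ∈ Set.Ioo (0 : ℝ) 1

/-- A rule by which agent `i`, at rounding step `τ` with current vector `y`, picks a pair of its
own fractional strategies, whenever there is one. The pick is arbitrary, possibly random. -/
def IsPairRule {A P : Type*} (strat : A → Finset P)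
    (pick : ℕ → A → (P → ℝ) → PMF (P × P)) : Prop :=
  ∀ τ i y, (∃ a, IsFractionalPair (strat i) y a) →
    ∀ a ∈ (pick τ i y).support, IsFractionalPair (strat i) y a

/-- The random exchange of probability mass between the strategies `p` and `q`. -/
def exchange {P : Type*} [DecidableEq P] (y : P → ℝ) (p q : P) : PMF (P → ℝ) :=
  let δp := min (y p) (1 - y q)
  let δq := min (1 - y p) (y q)
  (coin (δq / (δp + δq))).map fun b =>
    if b then Function.update (Function.update y p (y p - δp)) q (y q + δp)
    else Function.update (Function.update y q (y q - δq)) p (y p + δq)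

open Classical in
/-- One rounding step with own strategy set `Q`; nothing changes when no fractional pair is
left. -/
def pipageStep {P : Type*} [DecidableEq P] (Q : Finset P) (pick : (P → ℝ) → PMF (P × P))
    (y : P → ℝ) : PMF (P → ℝ) :=
  if ∃ a, IsFractionalPair Q y a then (pick y).bind fun a => exchange y a.1 a.2
  else PMF.pure y

/-- The law of the vector after `τ` rounding steps from the vector `x`. -/
def pipage {P : Type*} [DecidableEq P] (Q : Finset P) (pick : ℕ → (P → ℝ) → PMF (P × P))
    (x : P → ℝ) : ℕ → PMF (P → ℝ)
  | 0 => PMF.pure x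
  | τ + 1 => (pipage Q pick x τ).bind (pipageStep Q (pick τ))

open Classical in
/-- The law of the final set of one agent with strategy set `Q` and vector `x`: after `|Q|` steps
it takes those of its strategies whose rounded probability is `1`. -/
def roundAgent {P : Type*} [DecidableEq P] (Q : Finset P)
    (pick : ℕ → (P → ℝ) → PMF (P × P)) (x : P → ℝ) : PMF (Finset P) :=
  (pipage Q pick x Q.card).map fun y => Q.filter fun p => y p = 1

/-- The law of the union of the sets of all agents, which round their own vectors
independently. -/
def roundState {A P : Type*} [Fintype A] [DecidableEq A] [Fintype P] [DecidableEq P]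
    (strat : A → Finset P) (pick : ℕ → A → (P → ℝ) → PMF (P × P)) (x : A → P → ℝ) :
    PMF (Finset P) :=
  (indep fun i => roundAgent (strat i) (fun τ => pick τ i) (x i)).map fun R =>
    Finset.univ.biUnion R

/-- The law of the output of the whole algorithm. -/
def algorithmOutput {A P : Type*} [Fintype A] [DecidableEq A] [Fintype P] [DecidableEq P]
    (G : SimpleGraph A) (f : Finset P → ℝ) (strat : A → Finset P) (K : A → ℕ) (T : ℕ)
    (sel : ℕ → A → (P → ℝ) → (P → ℝ) → PMF (Finset P))
    (pick : ℕ → A → (P → ℝ) → PMF (P × P)) : PMF (Finset P) :=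
  (stateAfter G f K T sel T).bind (roundState strat pick)

end

end DistSubmod

/-! The algorithm is a continuous greedy ascent of the multilinear extension `mlext f`. Give every
strategy the value held by its owner (`combined`). Only the owner ever raises that coordinate, so
max-consensus leaves it unchanged, and one iteration adds exactly `1 / T` on the union of the
selected sets (`combined_step`): the ascent itself suffers no delay.

Three errors enter each step. The agents evaluate gradients at delayed vectors, but the lag is at
most `k * diam / T` in ℓ¹ norm and second differences lie in `[-c f{p}, 0]`. The gradients are
sampled, but Hoeffding's inequality keeps each within `f{p} / (4T)` of its mean, up to probability
`2 exp(-K / (8T²))`. The step has finite length, which costs a quadratic term. Against this,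
`sum_grad_ge` says that the gradient over the optimum sums to at least `f Rstar - c * mlext f z`.
Since top-weight selection does at least as well as the optimum on the estimated weights,
`mlext_combined_step_ge` gives the recursion `V(t+1) ≥ (1 - c/T) V(t) + B/T`, whose geometric sum
yields the factor `(1 - e^{-c}) / c`. Union bounds over strategies and iterations give the
probability.

Rounding loses nothing in expectation: a pipage exchange has mean zero, and by submodularity `mlext
f` is convex along the exchanged direction. Each exchange makes a coordinate integral, and the block
sum is the integer `κ i`, so the result is integral and admissible. -/

namespace DistSubmod

noncomputable section

set_option linter.unusedSectionVars false

/-! ### Expectations over finite types -/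

/-- The expectation of a real function on a finite type. -/
def mean {α : Type*} [Fintype α] (μ : PMF α) (g : α → ℝ) : ℝ := ∑ a, (μ a).toReal * g a

theorem mean_const {α : Type*} [Fintype α] (μ : PMF α) (r : ℝ) : mean μ (fun _ => r) = r := by
  have h := μ.tsum_coe
  rw [tsum_fintype] at h
  rw [mean, ← Finset.sum_mul, ← ENNReal.toReal_sum (fun a _ => μ.apply_ne_top a), h]
  simp

theorem mean_add {α : Type*} [Fintype α] (μ : PMF α) (g h : α → ℝ) :
    mean μ (fun a => g a + h a) = mean μ g + mean μ h := by
  simp [mean, mul_add, Finset.sum_add_distrib]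

theorem mean_sub {α : Type*} [Fintype α] (μ : PMF α) (g h : α → ℝ) :
    mean μ (fun a => g a - h a) = mean μ g - mean μ h := by
  simp [mean, mul_sub, Finset.sum_sub_distrib]

theorem mean_const_mul {α : Type*} [Fintype α] (μ : PMF α) (r : ℝ) (g : α → ℝ) :
    mean μ (fun a => r * g a) = r * mean μ g := by
  simp [mean, Finset.mul_sum, mul_left_comm]

theorem mean_neg {α : Type*} [Fintype α] (μ : PMF α) (g : α → ℝ) :
    mean μ (fun a => -g a) = -mean μ g := by
  simp [mean]

theorem mean_finset_sum {α ι : Type*} [Fintype α] (μ : PMF α) (s : Finset ι) (g : ι → α → ℝ) :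
    mean μ (fun a => ∑ i ∈ s, g i a) = ∑ i ∈ s, mean μ (g i) := by
  simp only [mean, Finset.mul_sum]
  exact Finset.sum_comm

theorem mean_mono {α : Type*} [Fintype α] (μ : PMF α) {g h : α → ℝ}
    (hgh : ∀ a ∈ μ.support, g a ≤ h a) : mean μ g ≤ mean μ h := by
  refine Finset.sum_le_sum fun a _ => ?_
  by_cases ha : a ∈ μ.support
  · exact mul_le_mul_of_nonneg_left (hgh a ha) ENNReal.toReal_nonneg
  · simp [(μ.apply_eq_zero_iff a).2 ha]

theorem mean_congr {α : Type*} [Fintype α] (μ : PMF α) {g h : α → ℝ}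
    (hgh : ∀ a ∈ μ.support, g a = h a) : mean μ g = mean μ h :=
  le_antisymm (mean_mono μ fun a ha => (hgh a ha).le) (mean_mono μ fun a ha => (hgh a ha).ge)

theorem mean_nonneg {α : Type*} [Fintype α] (μ : PMF α) {g : α → ℝ}
    (hg : ∀ a ∈ μ.support, 0 ≤ g a) : 0 ≤ mean μ g := by
  simpa [mean_const] using mean_mono μ (g := fun _ => 0) hg

theorem mean_map {α β : Type*} [Fintype α] [Fintype β] (μ : PMF α) (φ : α → β) (g : β → ℝ) :
    mean (μ.map φ) g = mean μ (g ∘ φ) := by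
  classical
  simp only [mean, PMF.map_apply, tsum_fintype]
  have : ∀ b, (∑ a, if b = φ a then μ a else 0).toReal * g b
      = ∑ a, if b = φ a then (μ a).toReal * g b else 0 := by
    intro b
    rw [ENNReal.toReal_sum (fun a _ => by split_ifs <;> simp [μ.apply_ne_top]), Finset.sum_mul]
    exact Finset.sum_congr rfl fun a _ => by split_ifs <;> simp
  simp only [this]
  rw [Finset.sum_comm]
  simp

theorem mean_eq_integral {α : Type*} [Fintype α] [MeasurableSpace α] [MeasurableSingletonClass α]
    (μ : PMF α) (g : α → ℝ) : ∫ a, g a ∂μ.toMeasure = mean μ g := by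
  simp [PMF.integral_eq_sum, mean]

/-- The expectation of a function with values in `ℝ≥0∞`. -/
def emean {α : Type*} (μ : PMF α) (g : α → ℝ≥0∞) : ℝ≥0∞ := ∑' a, μ a * g a

/-- States and rounded vectors range over infinite types, where sums in `ℝ≥0∞` need no summability;
this lemma returns to real expectations over finite types. -/
theorem emean_ofReal {α : Type*} [Fintype α] (μ : PMF α) {g : α → ℝ} (hg : ∀ a, 0 ≤ g a) :
    emean μ (fun a => ENNReal.ofReal (g a)) = ENNReal.ofReal (mean μ g) := by
  rw [emean, tsum_fintype, mean, ENNReal.ofReal_sum_of_nonneg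
    (fun a _ => mul_nonneg ENNReal.toReal_nonneg (hg a))]
  exact Finset.sum_congr rfl fun a _ => by
    rw [ENNReal.ofReal_mul ENNReal.toReal_nonneg, ENNReal.ofReal_toReal (μ.apply_ne_top a)]

theorem emean_pure {α : Type*} (a : α) (g : α → ℝ≥0∞) : emean (PMF.pure a) g = g a := by
  rw [emean, tsum_eq_single a]
  · simp
  · intro b hb
    simp [PMF.pure_apply_of_ne _ _ hb]

theorem emean_bind {α β : Type*} (μ : PMF α) (κ : α → PMF β) (g : β → ℝ≥0∞) :
    emean (μ.bind κ) g = emean μ fun a => emean (κ a) g := by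
  simp only [emean, PMF.bind_apply, ← ENNReal.tsum_mul_right, ← ENNReal.tsum_mul_left]
  rw [ENNReal.tsum_comm]
  simp only [mul_assoc]

theorem emean_map {α β : Type*} (μ : PMF α) (φ : α → β) (g : β → ℝ≥0∞) :
    emean (μ.map φ) g = emean μ (g ∘ φ) := by
  rw [← PMF.bind_pure_comp, emean_bind]
  simp [emean_pure, Function.comp_def]

theorem emean_mono {α : Type*} (μ : PMF α) {g h : α → ℝ≥0∞}
    (hgh : ∀ a ∈ μ.support, g a ≤ h a) : emean μ g ≤ emean μ h := by
  refine ENNReal.tsum_le_tsum fun a => ?_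
  by_cases ha : a ∈ μ.support
  · gcongr
    exact hgh a ha
  · simp [(μ.apply_eq_zero_iff a).2 ha]

theorem emean_const {α : Type*} (μ : PMF α) (r : ℝ≥0∞) : emean μ (fun _ => r) = r := by
  rw [emean, ENNReal.tsum_mul_right, μ.tsum_coe, one_mul]

theorem emean_add {α : Type*} (μ : PMF α) (g h : α → ℝ≥0∞) :
    emean μ (fun a => g a + h a) = emean μ g + emean μ h := by
  simp only [emean, mul_add, ENNReal.tsum_add]

theorem toOuterMeasure_eq_emean {α : Type*} (μ : PMF α) (s : Set α) :
    μ.toOuterMeasure s = emean μ (s.indicator 1) := by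
  rw [PMF.toOuterMeasure_apply]
  refine tsum_congr fun a => ?_
  by_cases ha : a ∈ s <;> simp [ha]

/-! ### Independent families -/

section Indep

variable {ι : Type*} [Fintype ι] [DecidableEq ι] {α : ι → Type*} [∀ i, Fintype (α i)]

theorem indep_apply (μ : ∀ i, PMF (α i)) (ω : ∀ i, α i) : indep μ ω = ∏ i, μ i (ω i) := rfl

theorem mem_support_indep {μ : ∀ i, PMF (α i)} {ω : ∀ i, α i} :
    ω ∈ (indep μ).support ↔ ∀ i, ω i ∈ (μ i).support := by
  simp [PMF.mem_support_iff, indep_apply, Finset.prod_ne_zero_iff]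

theorem mean_indep_prod (μ : ∀ i, PMF (α i)) (g : ∀ i, α i → ℝ) :
    mean (indep μ) (fun ω => ∏ i, g i (ω i)) = ∏ i, mean (μ i) (g i) := by
  simp only [mean, indep_apply, ENNReal.toReal_prod, ← Finset.prod_mul_distrib]
  exact (Fintype.prod_sum fun i a => (μ i a).toReal * g i a).symm

/-- The product weight splits off its factor at `i`, and the discarded old value has total mass one.
With `ν = μ i` this is conditioning on the other coordinates. -/
theorem mean_indep_update (μ : ∀ i, PMF (α i)) (i : ι) (ν : PMF (α i)) (g : (∀ i, α i) → ℝ) :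
    mean (indep μ) (fun ω => mean ν fun a => g (Function.update ω i a))
      = mean (indep (Function.update μ i ν)) g := by
  have key : ∀ (μ' : ∀ i, PMF (α i)) (h : (∀ i, α i) → ℝ), mean (indep μ') h =
      ∑ b : α i, ∑ r : ∀ j : {j // j ≠ i}, α j, ((μ' i b).toReal * ∏ j, (μ' j.1 (r j)).toReal) *
        h ((Equiv.piSplitAt i α).symm (b, r)) := by
    intro μ' h
    rw [mean, ← (Equiv.piSplitAt i α).symm.sum_comp, Fintype.sum_prod_type]
    refine Finset.sum_congr rfl fun b _ => Finset.sum_congr rfl fun r _ => ?_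
    congr 1
    rw [indep_apply, ENNReal.toReal_prod, Fintype.prod_eq_mul_prod_subtype_ne _ i]
    congr 1
    · simp [Equiv.piSplitAt]
    · refine Finset.prod_congr rfl fun j _ => ?_
      simp [Equiv.piSplitAt, j.2]
  have hup : ∀ (b : α i) (r : ∀ j : {j // j ≠ i}, α j) (a : α i),
      Function.update ((Equiv.piSplitAt i α).symm (b, r)) i a
        = (Equiv.piSplitAt i α).symm (a, r) := by
    intro b r a
    ext j
    by_cases hj : j = i
    · subst hj; simp [Equiv.piSplitAt]
    · simp [Equiv.piSplitAt, hj]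
  rw [key, key]
  simp only [hup, Function.update_self]
  have h1 : ∀ (r : ∀ j : {j // j ≠ i}, α j), ∏ j : {j // j ≠ i},
      ((Function.update μ i ν) j.1 (r j)).toReal = ∏ j : {j // j ≠ i}, (μ j.1 (r j)).toReal :=
    fun r => Finset.prod_congr rfl fun j _ => by rw [Function.update_of_ne j.2]
  simp only [h1]
  have hone : ∑ b, (μ i b).toReal = 1 := by simpa [mean] using mean_const (μ i) 1
  simp only [mul_assoc, ← Finset.mul_sum]
  rw [← Finset.sum_mul, hone, one_mul]
  simp only [mean, Finset.mul_sum]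
  rw [Finset.sum_comm]
  refine Finset.sum_congr rfl fun b _ => Finset.sum_congr rfl fun r _ => ?_
  ring

theorem mean_indep_eval (μ : ∀ i, PMF (α i)) (i : ι) (g : α i → ℝ) :
    mean (indep μ) (fun ω => g (ω i)) = mean (μ i) g := by
  have h := mean_indep_update μ i (μ i) fun ω => g (ω i)
  rw [Function.update_eq_self] at h
  rw [← h]
  simp only [Function.update_self]
  exact mean_const _ _

end Indep

/-! ### Hoeffding's inequality for the empirical mean -/

theorem mean_exp_le {α : Type*} [Fintype α] (μ : PMF α) {g : α → ℝ} {a b : ℝ} (hab : a ≤ b)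
    (hg : ∀ x, g x ∈ Set.Icc a b) (s : ℝ) :
    mean μ (fun x => Real.exp (s * (g x - mean μ g))) ≤ Real.exp (s ^ 2 * (b - a) ^ 2 / 8) := by
  let : MeasurableSpace α := ⊤
  have : MeasurableSingletonClass α := ⟨fun _ => trivial⟩
  have h := (ProbabilityTheory.hasSubgaussianMGF_of_mem_Icc (μ := μ.toMeasure) (X := g)
    (a := a) (b := b) (measurable_of_finite g).aemeasurable
    (Filter.Eventually.of_forall hg)).mgf_le s
  rw [ProbabilityTheory.mgf, mean_eq_integral, mean_eq_integral] at h
  refine h.trans (le_of_eq ?_)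
  congr 1
  push_cast
  rw [Real.norm_of_nonneg (sub_nonneg.2 hab)]
  ring

/-- The indicator of a proposition. -/
def ind (p : Prop) : ℝ := by
  classical exact if p then 1 else 0

theorem ind_of_true {p : Prop} (h : p) : ind p = 1 := if_pos h

theorem ind_of_false {p : Prop} (h : ¬ p) : ind p = 0 := if_neg h

theorem ind_nonneg (p : Prop) : 0 ≤ ind p := by
  by_cases h : p
  · simp [ind_of_true h]
  · simp [ind_of_false h]

/-- Chernoff's method: the indicator is dominated by an exponential, which factorizes by
independence, and Hoeffding's lemma bounds each factor. -/
theorem mean_ind_sum_ge_le {α : Type*} [Fintype α] (μ : PMF α) {g : α → ℝ} {a b : ℝ} (hab : a < b)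
    (hg : ∀ x, g x ∈ Set.Icc a b) {k : ℕ} {ε : ℝ} (hε : 0 ≤ ε) :
    mean (indep fun _ : Fin k => μ)
        (fun ω => ind (k * (ε * (b - a)) ≤ ∑ l, (g (ω l) - mean μ g)))
      ≤ Real.exp (-(2 * k * ε ^ 2)) := by
  have hba : 0 < b - a := sub_pos.2 hab
  -- The minimizer of `-s ε (b - a) + s² (b - a)² / 8`.
  set s : ℝ := 4 * ε / (b - a) with hs
  have hs0 : 0 ≤ s := by positivity
  calc mean (indep fun _ : Fin k => μ)
        (fun ω => ind (k * (ε * (b - a)) ≤ ∑ l, (g (ω l) - mean μ g)))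
      ≤ mean (indep fun _ : Fin k => μ) (fun ω => Real.exp (-(4 * k * ε ^ 2)) *
          ∏ l, Real.exp (s * (g (ω l) - mean μ g))) := by
        refine mean_mono _ fun ω _ => ?_
        by_cases h : k * (ε * (b - a)) ≤ ∑ l, (g (ω l) - mean μ g)
        · rw [ind_of_true h, ← Real.exp_sum, ← Real.exp_add, ← Finset.mul_sum]
          apply Real.one_le_exp
          have h1 := mul_le_mul_of_nonneg_left h hs0
          have h2 : s * (k * (ε * (b - a))) = 4 * k * ε ^ 2 := by
            rw [hs]; field_simp
          linarith
        · rw [ind_of_false h]; positivity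
    _ = Real.exp (-(4 * k * ε ^ 2)) *
          ∏ _l : Fin k, mean μ (fun x => Real.exp (s * (g x - mean μ g))) := by
        rw [mean_const_mul, mean_indep_prod (fun _ : Fin k => μ)
          (fun _ x => Real.exp (s * (g x - mean μ g)))]
    _ ≤ Real.exp (-(4 * k * ε ^ 2)) * ∏ _l : Fin k, Real.exp (2 * ε ^ 2) := by
        refine mul_le_mul_of_nonneg_left ?_ (Real.exp_pos _).le
        refine Finset.prod_le_prod (fun _ _ => mean_nonneg _ fun _ _ => (Real.exp_pos _).le)
          fun _ _ => ?_
        refine (mean_exp_le μ hab.le hg s).trans (le_of_eq ?_)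
        congr 1
        rw [hs]; field_simp; ring
    _ = Real.exp (-(2 * k * ε ^ 2)) := by
        rw [Finset.prod_const, Finset.card_univ, Fintype.card_fin, ← Real.exp_nat_mul,
          ← Real.exp_add]
        congr 1; ring

theorem mean_ind_deviation_le {α : Type*} [Fintype α] (μ : PMF α) {g : α → ℝ} {b : ℝ}
    (hb : 0 ≤ b) (hg : ∀ x, g x ∈ Set.Icc 0 b) {k : ℕ} (hk : 0 < k) {ε : ℝ} (hε : 0 ≤ ε) :
    mean (indep fun _ : Fin k => μ)
        (fun ω => ind (ε * b < |(∑ l, g (ω l)) / k - mean μ g|))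
      ≤ 2 * Real.exp (-(2 * k * ε ^ 2)) := by
  have hk' : (0 : ℝ) < k := by exact_mod_cast hk
  rcases hb.eq_or_lt with rfl | hb
  -- For `b = 0` the variable vanishes and the strict inequality makes the event empty.
  · have hg0 : ∀ x, g x = 0 := fun x => le_antisymm (hg x).2 (hg x).1
    have hm : mean μ g = 0 := by simp [mean, hg0]
    rw [mean_congr _ (h := fun _ => 0) fun ω _ => ind_of_false (by simp [hg0, hm]), mean_const]
    positivity
  · have h1 := mean_ind_sum_ge_le μ hb hg (k := k) hε
    have h2 := mean_ind_sum_ge_le μ (neg_lt_zero.2 hb) (g := fun x => -g x)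
      (fun x => ⟨neg_le_neg (hg x).2, neg_nonpos.2 (hg x).1⟩) (k := k) hε
    rw [two_mul]
    refine le_trans ?_ (add_le_add h1 h2)
    rw [← mean_add]
    refine mean_mono _ fun ω _ => ?_
    by_cases h : ε * b < |(∑ l, g (ω l)) / k - mean μ g|
    · rw [ind_of_true h]
      rw [mean_neg]
      have e1 : ∑ l, (g (ω l) - mean μ g) = k * ((∑ l, g (ω l)) / k - mean μ g) := by
        rw [Finset.sum_sub_distrib]; simp; field_simp
      have e2 : ∑ l, (-g (ω l) - -mean μ g) = k * -((∑ l, g (ω l)) / k - mean μ g) := by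
        rw [mul_neg, ← e1, ← Finset.sum_neg_distrib]
        exact Finset.sum_congr rfl fun _ _ => by ring
      rcases lt_abs.1 h with h' | h'
      · rw [ind_of_true (p := k * (ε * (b - 0)) ≤ _)]
        · linarith [ind_nonneg (k * (ε * (0 - -b)) ≤ ∑ l, (-g (ω l) - -mean μ g))]
        · rw [e1, sub_zero]
          exact mul_le_mul_of_nonneg_left h'.le hk'.le
      · rw [ind_of_true (p := k * (ε * (0 - -b)) ≤ _)]
        · linarith [ind_nonneg (k * (ε * (b - 0)) ≤ ∑ l, (g (ω l) - mean μ g))]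
        · rw [e2, zero_sub, neg_neg]
          exact mul_le_mul_of_nonneg_left h'.le hk'.le
    · rw [ind_of_false h]
      exact add_nonneg (ind_nonneg _) (ind_nonneg _)

/-! ### The multilinear extension -/

section Multilinear

variable {P : Type*} [Fintype P] [DecidableEq P]

/-- The multilinear extension of `g` at `x ∈ [0, 1]^P`. -/
def mlext (g : Finset P → ℝ) (x : P → ℝ) : ℝ := expect (randomSet x) g

/-- The points of the unit cube. -/
def InCube (x : P → ℝ) : Prop := ∀ p, x p ∈ Set.Icc (0 : ℝ) 1

theorem mlext_eq_mean (g : Finset P → ℝ) (x : P → ℝ) : mlext g x =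
    mean (indep fun p => coin (x p)) fun b => g (Finset.univ.filter fun p => b p = true) :=
  mean_map _ _ _

theorem mlext_const (r : ℝ) (x : P → ℝ) : mlext (fun _ => r) x = r := mean_const _ r

theorem mlext_mono {g h : Finset P → ℝ} (x : P → ℝ) (hgh : ∀ R, g R ≤ h R) :
    mlext g x ≤ mlext h x := mean_mono _ fun R _ => hgh R

theorem mlext_nonneg {g : Finset P → ℝ} (x : P → ℝ) (hg : ∀ R, 0 ≤ g R) : 0 ≤ mlext g x :=
  mean_nonneg _ fun R _ => hg R

theorem mlext_add (g h : Finset P → ℝ) (x : P → ℝ) :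
    mlext (fun R => g R + h R) x = mlext g x + mlext h x := mean_add _ g h

theorem mlext_sub (g h : Finset P → ℝ) (x : P → ℝ) :
    mlext (fun R => g R - h R) x = mlext g x - mlext h x := mean_sub _ g h

theorem mlext_neg (g : Finset P → ℝ) (x : P → ℝ) :
    mlext (fun R => -g R) x = -mlext g x := mean_neg _ g

theorem mlext_const_mul (r : ℝ) (g : Finset P → ℝ) (x : P → ℝ) :
    mlext (fun R => r * g R) x = r * mlext g x := mean_const_mul _ r g

theorem mlext_finset_sum {ι : Type*} (s : Finset ι) (g : ι → Finset P → ℝ) (x : P → ℝ) :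
    mlext (fun R => ∑ i ∈ s, g i R) x = ∑ i ∈ s, mlext (g i) x := mean_finset_sum _ s g

theorem mean_coin {r : ℝ} (hr : r ∈ Set.Icc (0 : ℝ) 1) (g : Bool → ℝ) :
    mean (coin r) g = r * g true + (1 - r) * g false := by
  have h : max 0 (min 1 r) = r := by rw [min_eq_right hr.2, max_eq_right hr.1]
  simp only [mean, Fintype.sum_bool, coin, PMF.ofFintype_apply, cond_true, cond_false, h]
  rw [ENNReal.toReal_ofReal hr.1, ENNReal.toReal_ofReal (sub_nonneg.2 hr.2)]

/-- Condition on whether `p` is in the random set; this is affinity in each coordinate. -/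
theorem mlext_update (g : Finset P → ℝ) (x : P → ℝ) (p : P) {a : ℝ}
    (ha : a ∈ Set.Icc (0 : ℝ) 1) :
    mlext g (Function.update x p a) =
      a * mlext (fun R => g (insert p R)) x + (1 - a) * mlext (fun R => g (R.erase p)) x := by
  have h1 : (fun q => coin (Function.update x p a q))
      = Function.update (fun q => coin (x q)) p (coin a) := by
    ext1 q
    by_cases hq : q = p
    · subst hq; simp
    · simp [hq]
  rw [mlext_eq_mean, h1, ← mean_indep_update, mlext_eq_mean, mlext_eq_mean, ← mean_const_mul,
    ← mean_const_mul, ← mean_add]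
  refine mean_congr _ fun ω _ => ?_
  rw [mean_coin ha]
  congr 3
  · ext q
    by_cases hq : q = p
    · subst hq; simp
    · simp [hq]
  · ext q
    by_cases hq : q = p
    · subst hq; simp
    · simp [hq]

theorem InCube.update {x : P → ℝ} (hx : InCube x) (p : P) {a : ℝ}
    (ha : a ∈ Set.Icc (0 : ℝ) 1) : InCube (Function.update x p a) := by
  intro q
  by_cases hq : q = p
  · subst hq; simpa using ha
  · simpa [hq] using hx q

theorem mlext_update_sub (g : Finset P → ℝ) {x : P → ℝ} (hx : InCube x) (p : P) {a : ℝ}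
    (ha : a ∈ Set.Icc (0 : ℝ) 1) :
    mlext g (Function.update x p a) - mlext g x =
      (a - x p) * mlext (fun R => g (insert p R) - g (R.erase p)) x := by
  have h := mlext_update g x p (hx p)
  rw [Function.update_eq_self] at h
  rw [mlext_update g x p ha, h, mlext_sub]
  ring

/-- The partial derivative of the multilinear extension. -/
def grad (f : Finset P → ℝ) (x : P → ℝ) (p : P) : ℝ :=
  mlext (fun R => f (insert p R) - f (R.erase p)) x

theorem piecewise_insert_update (s : Finset P) (p : P) (x y : P → ℝ) :
    (insert p s).piecewise y x = Function.update (s.piecewise y x) p (y p) :=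
  Finset.piecewise_insert s y x p

theorem InCube.piecewise {x y : P → ℝ} (hx : InCube x) (hy : InCube y) (s : Finset P) :
    InCube (s.piecewise y x) := fun p => by
  by_cases hp : p ∈ s
  · simpa [hp] using hy p
  · simpa [hp] using hx p

/-- Move from `x` to `y` one coordinate at a time; each move multiplies an increment by an average
of first differences. With `g` itself a (negated) first difference of `f`, this yields monotonicity
and Lipschitz bounds for `grad`. -/
theorem le_mlext_of_le {g : Finset P → ℝ} {x y : P → ℝ} (hx : InCube x) (hy : InCube y)
    (hxy : x ≤ y) {l : ℝ} (hl : ∀ q R, l ≤ g (insert q R) - g (R.erase q)) :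
    mlext g x + l * ∑ q, (y q - x q) ≤ mlext g y := by
  have key : ∀ s : Finset P,
      mlext g x + l * ∑ q ∈ s, (y q - x q) ≤ mlext g (s.piecewise y x) := by
    intro s
    induction s using Finset.induction_on with
    | empty => simp
    | insert p s hp ih =>
      have h := mlext_update_sub g (hx.piecewise hy s) p (hy p)
      rw [Finset.piecewise_eq_of_notMem _ _ _ hp] at h
      rw [piecewise_insert_update, Finset.sum_insert hp]
      have h2 : l ≤ mlext (fun R => g (insert p R) - g (R.erase p)) (s.piecewise y x) := by
        rw [← mlext_const l (s.piecewise y x)]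
        exact mlext_mono _ (hl p)
      nlinarith [mul_le_mul_of_nonneg_left h2 (sub_nonneg.2 (hxy p))]
  simpa using key Finset.univ

theorem mlext_congr {g : Finset P → ℝ} {x y : P → ℝ} (hx : InCube x) (hy : InCube y)
    (h : ∀ q, x q = y q ∨ ∀ R, g (insert q R) = g (R.erase q)) : mlext g x = mlext g y := by
  have key : ∀ s : Finset P, mlext g (s.piecewise y x) = mlext g x := by
    intro s
    induction s using Finset.induction_on with
    | empty => simp
    | insert p s hp ih =>
      have h1 := mlext_update_sub g (hx.piecewise hy s) p (hy p)
      rw [Finset.piecewise_eq_of_notMem _ _ _ hp] at h1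
      rw [piecewise_insert_update, ← ih, ← sub_eq_zero, h1]
      rcases h p with h' | h'
      · rw [h']; simp
      · simp [h', mlext_const]
  simpa using (key Finset.univ).symm

theorem mem_support_randomSet {x : P → ℝ} {R : Finset P} (hR : R ∈ (randomSet x).support) (p : P) :
    (x p = 1 → p ∈ R) ∧ (x p = 0 → p ∉ R) := by
  rw [randomSet, PMF.mem_support_map_iff] at hR
  obtain ⟨b, hb, rfl⟩ := hR
  have h := mem_support_indep.1 hb p
  rw [PMF.mem_support_iff, coin, PMF.ofFintype_apply] at h
  constructor
  · intro h1
    cases hbp : b p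
    · simp [h1, hbp] at h
    · simp [hbp]
  · intro h1
    cases hbp : b p
    · simp [hbp]
    · simp [h1, hbp] at h

end Multilinear

/-! ### Curvature -/

section Curvature

variable {P : Type*} [Fintype P] [DecidableEq P] {f : Finset P → ℝ}

theorem marginal_nonneg (hmono : Monotone f) (p : P) (S : Finset P) : 0 ≤ marginal f p S :=
  sub_nonneg.2 (hmono (Finset.subset_insert p S))

theorem le_marginal (hmono : Monotone f) {p : P} {S : Finset P} (hp : p ∉ S) :
    (1 - curvature f) * marginal f p ∅ ≤ marginal f p S := by
  by_cases h0 : marginal f p ∅ = 0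
  · rw [h0, mul_zero]
    exact marginal_nonneg hmono p S
  · have hpos : 0 < marginal f p ∅ := lt_of_le_of_ne (marginal_nonneg hmono p ∅) (Ne.symm h0)
    have hmem : (S, p) ∈ curvaturePairs f := by simp [curvaturePairs, hp, h0]
    have hne : (curvaturePairs f).Nonempty := ⟨_, hmem⟩
    rw [curvature, dif_pos hne, sub_sub_cancel, ← le_div_iff₀ hpos]
    exact Finset.inf'_le (fun a : Finset P × P => marginal f a.2 a.1 / marginal f a.2 ∅) hmem

theorem curvature_mem_Icc (hmono : Monotone f) : curvature f ∈ Set.Icc (0 : ℝ) 1 := by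
  rw [curvature]
  split_ifs with hne
  · constructor
    · obtain ⟨⟨S, p⟩, hSp⟩ := hne
      have hp : marginal f p ∅ ≠ 0 := by
        simp only [curvaturePairs, Finset.mem_filter] at hSp
        exact hSp.2.2
      have hmem : ((∅ : Finset P), p) ∈ curvaturePairs f := by simp [curvaturePairs, hp]
      -- The pair `(∅, p)` has ratio one, so the minimum is at most one.
      have h := Finset.inf'_le (fun a : Finset P × P => marginal f a.2 a.1 / marginal f a.2 ∅) hmem
      simp only [div_self hp] at h
      linarith
    · rw [sub_le_self_iff]
      exact Finset.le_inf' _ _ fun a _ =>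
        div_nonneg (marginal_nonneg hmono _ _) (marginal_nonneg hmono _ _)
  · simp

theorem marginal_empty (hnorm : Normalized f) (p : P) : marginal f p ∅ = f {p} := by
  have h : f ∅ = 0 := hnorm
  simp [marginal, h]

theorem nonneg_of_monotone (hnorm : Normalized f) (hmono : Monotone f) (S : Finset P) : 0 ≤ f S := by
  have h : f ∅ = 0 := hnorm
  rw [← h]
  exact hmono (Finset.empty_subset S)

theorem marginal_le (hnorm : Normalized f) (hsub : Submodular f) {p : P} {S : Finset P}
    (hp : p ∉ S) : marginal f p S ≤ f {p} := by
  rw [← marginal_empty hnorm]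
  exact hsub ∅ S (Finset.empty_subset S) p hp

theorem insert_sub_erase (f : Finset P → ℝ) (p : P) (R : Finset P) :
    f (insert p R) - f (R.erase p) = marginal f p (R.erase p) := by
  rw [marginal]
  congr 2
  ext q
  by_cases hq : q = p <;> simp [hq]

theorem insert_sub_erase_mem_Icc (hnorm : Normalized f) (hmono : Monotone f) (hsub : Submodular f)
    (p : P) (R : Finset P) : f (insert p R) - f (R.erase p) ∈ Set.Icc 0 (f {p}) := by
  rw [insert_sub_erase]
  exact ⟨marginal_nonneg hmono _ _, marginal_le hnorm hsub (Finset.notMem_erase p R)⟩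

/-- Bounds on the second differences. -/
theorem second_difference_mem_Icc (hnorm : Normalized f) (hmono : Monotone f)
    (hsub : Submodular f) (p q : P) (R : Finset P) :
    (f (insert p (insert q R)) - f ((insert q R).erase p)) -
      (f (insert p (R.erase q)) - f ((R.erase q).erase p))
        ∈ Set.Icc (-(curvature f * f {p})) 0 := by
  have hc := (curvature_mem_Icc hmono).1
  rw [insert_sub_erase, insert_sub_erase]
  by_cases hpq : p = q
  · subst hpq
    have : (insert p R).erase p = (R.erase p).erase p := by simp
    rw [this, sub_self]
    refine ⟨?_, le_rfl⟩
    have := mul_nonneg hc (nonneg_of_monotone hnorm hmono {p})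
    linarith
  · constructor
    · have h1 := le_marginal hmono (Finset.notMem_erase p (insert q R))
      have h2 := marginal_le hnorm hsub (Finset.notMem_erase p (R.erase q))
      rw [marginal_empty hnorm] at h1
      linarith
    · refine sub_nonpos.2 (hsub _ _ ?_ p (Finset.notMem_erase p _))
      exact Finset.erase_subset_erase _
        ((Finset.erase_subset _ _).trans (Finset.subset_insert _ _))

theorem grad_anti (hnorm : Normalized f) (hmono : Monotone f) (hsub : Submodular f)
    {x y : P → ℝ} (hx : InCube x) (hy : InCube y) (hxy : x ≤ y) (p : P) :
    grad f y p ≤ grad f x p := by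
  have h := le_mlext_of_le (g := fun R => -(f (insert p R) - f (R.erase p))) hx hy hxy (l := 0)
    fun q R => by
      have := (second_difference_mem_Icc hnorm hmono hsub p q R).2
      linarith
  rw [mlext_neg, mlext_neg, zero_mul, add_zero] at h
  exact neg_le_neg_iff.1 h

theorem le_grad (hnorm : Normalized f) (hmono : Monotone f) (hsub : Submodular f)
    {x y : P → ℝ} (hx : InCube x) (hy : InCube y) (hxy : x ≤ y) (p : P) :
    grad f x p - curvature f * f {p} * ∑ q, (y q - x q) ≤ grad f y p := by
  have h := le_mlext_of_le (g := fun R => f (insert p R) - f (R.erase p)) hx hy hxy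
    fun q R => (second_difference_mem_Icc hnorm hmono hsub p q R).1
  rw [neg_mul, ← sub_eq_add_neg] at h
  exact h

/-- Bound `f (S ∪ R)` above by adding `S \ R` to `R` (submodularity) and below by adding `R \ S` to
`S` (curvature). The gains on `S ∩ R` are at least `1 - c` times the singleton values, so these
values appear over all of `R`, where they sum to at least `f R`. -/
theorem sum_marginals_ge (hnorm : Normalized f) (hmono : Monotone f) (hsub : Submodular f)
    (S R : Finset P) :
    f S - curvature f * f R ≤ ∑ p ∈ S, (f (insert p R) - f (R.erase p)) := by
  set c := curvature f
  have hc1 : 0 ≤ 1 - c := sub_nonneg.2 (curvature_mem_Icc hmono).2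
  have h1 : ∀ U : Finset P, U ⊆ R → f U ≤ ∑ p ∈ U, f {p} := by
    intro U
    induction U using Finset.induction_on with
    | empty => intro _; simpa using (show f ∅ = 0 from hnorm).le
    | insert p U hp ih =>
      intro hU
      rw [Finset.sum_insert hp]
      have := marginal_le hnorm hsub hp
      rw [marginal] at this
      have := ih ((Finset.subset_insert _ _).trans hU)
      linarith
  have h2 : ∀ U : Finset P, U ⊆ S → Disjoint U R →
      f (R ∪ U) ≤ f R + ∑ p ∈ U, (f (insert p R) - f (R.erase p)) := by
    intro U
    induction U using Finset.induction_on with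
    | empty => simp
    | insert p U hp ih =>
      intro hU hUR
      rw [Finset.disjoint_insert_left] at hUR
      rw [Finset.sum_insert hp, Finset.union_insert]
      have hi := ih ((Finset.subset_insert _ _).trans hU) hUR.2
      have hs := hsub R (R ∪ U) Finset.subset_union_left p (by simp [hp, hUR.1])
      rw [marginal, marginal] at hs
      rw [Finset.erase_eq_of_notMem hUR.1]
      linarith
  have h3 : ∀ U : Finset P, U ⊆ R → Disjoint U S → f S + (1 - c) * ∑ p ∈ U, f {p} ≤ f (S ∪ U) := by
    intro U
    induction U using Finset.induction_on with
    | empty => simp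
    | insert p U hp ih =>
      intro hU hUS
      rw [Finset.disjoint_insert_left] at hUS
      rw [Finset.sum_insert hp, Finset.union_insert, mul_add]
      have hi := ih ((Finset.subset_insert _ _).trans hU) hUS.2
      have hs := le_marginal hmono (p := p) (S := S ∪ U) (by simp [hp, hUS.1])
      rw [marginal_empty hnorm, marginal] at hs
      linarith
  have h4 : (1 - c) * ∑ p ∈ S ∩ R, f {p} ≤ ∑ p ∈ S ∩ R, (f (insert p R) - f (R.erase p)) := by
    rw [Finset.mul_sum]
    refine Finset.sum_le_sum fun p _ => ?_
    rw [insert_sub_erase, ← marginal_empty hnorm]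
    exact le_marginal hmono (Finset.notMem_erase p R)
  have hsplit := Finset.sum_sdiff_eq_sub (f := fun p => f (insert p R) - f (R.erase p))
    (Finset.inter_subset_left (s₁ := S) (s₂ := R))
  rw [Finset.sdiff_inter_self_left] at hsplit
  have hsplit' := Finset.sum_sdiff_eq_sub (f := fun p => f {p})
    (Finset.inter_subset_right (s₁ := S) (s₂ := R))
  rw [Finset.sdiff_inter_self_right] at hsplit'
  have e2 := h2 (S \ R) Finset.sdiff_subset Finset.sdiff_disjoint
  have e3 := h3 (R \ S) Finset.sdiff_subset Finset.sdiff_disjoint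
  rw [Finset.union_sdiff_self_eq_union] at e2 e3
  rw [Finset.union_comm] at e3
  have e1 := mul_le_mul_of_nonneg_left (h1 R subset_rfl) hc1
  rw [hsplit] at e2
  rw [hsplit', mul_sub] at e3
  linarith

theorem sum_grad_ge (hnorm : Normalized f) (hmono : Monotone f) (hsub : Submodular f)
    (S : Finset P) (x : P → ℝ) :
    f S - curvature f * mlext f x ≤ ∑ p ∈ S, grad f x p := by
  have h := mlext_mono x (sum_marginals_ge hnorm hmono hsub S)
  rw [mlext_sub, mlext_const, mlext_const_mul, mlext_finset_sum] at h
  exact h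

/-- Raise the coordinates of `S` in turn: after `j` raises the next partial derivative has dropped
by at most `c F j ε`. -/
theorem mlext_add_indicator_ge (hnorm : Normalized f) (hmono : Monotone f) (hsub : Submodular f)
    {x : P → ℝ} (hx : InCube x) {ε F : ℝ} (hε : 0 ≤ ε) (hF : ∀ p, f {p} ≤ F) (S : Finset P)
    (hS : ∀ p ∈ S, x p + ε ≤ 1) :
    mlext f x + ε * ∑ p ∈ S, grad f x p - curvature f * F * ε ^ 2 * (S.card : ℝ) ^ 2 / 2 ≤
      mlext f (fun p => x p + if p ∈ S then ε else 0) := by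
  have hc := (curvature_mem_Icc hmono).1
  induction S using Finset.induction_on with
  | empty => simp
  | insert p S hp ih =>
    have ih := ih fun q hq => hS q (Finset.mem_insert_of_mem hq)
    have hp1 := hS p (Finset.mem_insert_self p S)
    have hF0 : 0 ≤ F := (nonneg_of_monotone hnorm hmono {p}).trans (hF p)
    set y : P → ℝ := fun q => x q + if q ∈ S then ε else 0 with hy
    have hyc : InCube y := fun q => by
      by_cases hq : q ∈ S
      · simp only [hy, hq, if_true]
        exact ⟨add_nonneg (hx q).1 hε, hS q (Finset.mem_insert_of_mem hq)⟩
      · simpa [hy, hq] using hx q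
    have hxy : x ≤ y := fun q => by
      simp only [hy, le_add_iff_nonneg_right]
      split_ifs <;> simp [hε]
    have hyp : y p = x p := by simp [hy, hp]
    have hup : (fun q => x q + if q ∈ insert p S then ε else 0)
        = Function.update y p (x p + ε) := by
      ext q
      by_cases hq : q = p
      · subst hq; simp
      · simp [hq, hy]
    have hsum : ∑ q, (y q - x q) = S.card * ε := by
      simp [hy, Finset.sum_ite_mem]
    have h1 := mlext_update_sub f hyc p (a := x p + ε) ⟨add_nonneg (hx p).1 hε, hp1⟩
    have h2 := le_grad hnorm hmono hsub hx hyc hxy p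
    rw [hyp, add_sub_cancel_left] at h1
    rw [hsum] at h2
    change _ = ε * grad f y p at h1
    rw [hup, Finset.sum_insert hp, Finset.card_insert_of_notMem hp]
    have h3 : curvature f * f {p} * (S.card * ε) ≤ curvature f * F * (S.card * ε) := by
      have := hF p
      gcongr
    have h4 := mul_le_mul_of_nonneg_left (show grad f x p - curvature f * F * (S.card * ε)
      ≤ grad f y p by linarith) hε
    -- Passing from `m² / 2` to `(m + 1)² / 2` allows `m + 1/2` units of this, while only `m` are
    -- lost.
    have h5 : 0 ≤ curvature f * F * ε ^ 2 := by positivity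
    push_cast
    nlinarith

end Curvature

/-! ### Pipage rounding -/

section Rounding

variable {P : Type*} [Fintype P] [DecidableEq P]

theorem min_mem_Ioc {a b : ℝ} (ha : a ∈ Set.Ioo (0 : ℝ) 1) (hb : b ∈ Set.Ioo (0 : ℝ) 1) :
    0 < min a (1 - b) ∧ min a (1 - b) ≤ a ∧ min a (1 - b) ≤ 1 - b :=
  ⟨lt_min ha.1 (sub_pos.2 hb.2), min_le_left _ _, min_le_right _ _⟩

/-- Each outcome moves as far as the unit square allows, so one coordinate reaches `0` or `1`. -/
theorem exists_of_mem_support_exchange {y y' : P → ℝ} {p q : P} (hp : y p ∈ Set.Ioo (0 : ℝ) 1)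
    (hq : y q ∈ Set.Ioo (0 : ℝ) 1) (hpq : p ≠ q) (hy' : y' ∈ (exchange y p q).support) :
    ∃ u v, y' = Function.update (Function.update y p u) q v ∧ u ∈ Set.Icc (0 : ℝ) 1 ∧
      v ∈ Set.Icc (0 : ℝ) 1 ∧ u + v = y p + y q ∧
      (u ∉ Set.Ioo (0 : ℝ) 1 ∨ v ∉ Set.Ioo (0 : ℝ) 1) := by
  obtain ⟨h1, h2, h3⟩ := min_mem_Ioc hp hq
  obtain ⟨h4, h5, h6⟩ := min_mem_Ioc hq hp
  rw [min_comm] at h4 h5 h6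
  obtain ⟨hp0, hp1⟩ := hp
  obtain ⟨hq0, hq1⟩ := hq
  rw [exchange, PMF.mem_support_map_iff] at hy'
  obtain ⟨b, -, rfl⟩ := hy'
  cases b
  · refine ⟨_, _, (by rw [if_neg (by simp), Function.update_comm hpq.symm]), ⟨by linarith, by linarith⟩,
      ⟨by linarith, by linarith⟩, by ring, ?_⟩
    rcases min_choice (1 - y p) (y q) with h | h
    · left; rw [h]; simp
    · right; rw [h]; simp
  · refine ⟨_, _, if_pos rfl, ⟨by linarith, by linarith⟩, ⟨by linarith, by linarith⟩, by ring, ?_⟩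
    rcases min_choice (y p) (1 - y q) with h | h
    · left; rw [h]; simp
    · right; rw [h]; simp

theorem mlext_update_update (h : Finset P → ℝ) (w : P → ℝ) (p q : P) {u v : ℝ}
    (hu : u ∈ Set.Icc (0 : ℝ) 1) (hv : v ∈ Set.Icc (0 : ℝ) 1) :
    mlext h (Function.update (Function.update w p u) q v) =
      v * (u * mlext (fun R => h (insert q (insert p R))) w +
        (1 - u) * mlext (fun R => h (insert q (R.erase p))) w) +
      (1 - v) * (u * mlext (fun R => h ((insert p R).erase q)) w +
        (1 - u) * mlext (fun R => h ((R.erase p).erase q)) w) := by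
  rw [mlext_update _ _ _ hv, mlext_update _ _ _ hu, mlext_update _ _ _ hu]

theorem Submodular.insert_insert_le {h : Finset P → ℝ} (hsub : Submodular h) {p q : P}
    (hpq : p ≠ q) (R : Finset P) :
    h (insert q (insert p R)) + h ((R.erase p).erase q)
      ≤ h (insert q (R.erase p)) + h ((insert p R).erase q) := by
  set S := (R.erase p).erase q
  have h1 : insert q (insert p R) = insert p (insert q S) := by grind
  have h2 : insert q (R.erase p) = insert q S := by grind
  have h3 : (insert p R).erase q = insert p S := by grind
  have := hsub S (insert q S) (Finset.subset_insert _ _) p (by grind)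
  rw [marginal, marginal] at this
  rw [h1, h2, h3]
  linarith

/-- With `u + v` fixed, `mlext h` is quadratic in the shift, with leading coefficient `B + C - A - D
≥ 0`. The shift has mean zero and variance `δp * δq`, so the expected gain is exactly `δp * δq * (B
+ C - A - D)`. -/
theorem le_emean_exchange {h : Finset P → ℝ} (hsub : Submodular h) (hpos : ∀ R, 0 ≤ h R)
    {Q : Finset P} {y z : P → ℝ} {p q : P} (hpQ : p ∈ Q) (hqQ : q ∈ Q) (hpq : p ≠ q)
    (hp : y p ∈ Set.Ioo (0 : ℝ) 1) (hq : y q ∈ Set.Ioo (0 : ℝ) 1) :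
    ENNReal.ofReal (mlext h (Q.piecewise y z)) ≤
      emean (exchange y p q) fun y' => ENNReal.ofReal (mlext h (Q.piecewise y' z)) := by
  obtain ⟨h1, h2, h3⟩ := min_mem_Ioc hp hq
  obtain ⟨h4, h5, h6⟩ := min_mem_Ioc hq hp
  rw [min_comm] at h4 h5 h6
  obtain ⟨hp0, hp1⟩ := hp
  obtain ⟨hq0, hq1⟩ := hq
  rw [exchange, emean_map]
  set δp := min (y p) (1 - y q)
  set δq := min (1 - y p) (y q)
  have hd : 0 < δp + δq := by linarith
  have hr : δq / (δp + δq) ∈ Set.Icc (0 : ℝ) 1 :=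
    ⟨by positivity, by rw [div_le_one hd]; linarith⟩
  simp only [Function.comp_def]
  rw [emean_ofReal _ fun _ => mlext_nonneg _ hpos]
  apply ENNReal.ofReal_le_ofReal
  rw [mean_coin hr]
  set w := Q.piecewise y z
  have hw : ∀ u v, Q.piecewise (Function.update (Function.update y p u) q v) z
      = Function.update (Function.update w p u) q v := by
    intro u v
    ext r
    by_cases hrq : r = q
    · subst hrq; simp [hqQ]
    · by_cases hrp : r = p
      · subst hrp; simp [hpQ, hrq]
      · by_cases hrQ : r ∈ Q <;> simp [w, hrq, hrp, hrQ]
  have hw0 : w = Function.update (Function.update w p (y p)) q (y q) := by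
    rw [← hw]; simp [w]
  rw [if_pos rfl, if_neg (by simp), Function.update_comm hpq.symm, hw, hw]
  nth_rw 1 [hw0]
  rw [mlext_update_update _ _ _ _ ⟨by linarith, by linarith⟩ ⟨by linarith, by linarith⟩,
    mlext_update_update _ _ _ _ ⟨by linarith, by linarith⟩ ⟨by linarith, by linarith⟩,
    mlext_update_update _ _ _ _ ⟨by linarith, by linarith⟩ ⟨by linarith, by linarith⟩]
  have hD := mlext_mono w (hsub.insert_insert_le hpq)
  rw [mlext_add, mlext_add] at hD
  set A := mlext (fun R => h (insert q (insert p R))) w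
  set B := mlext (fun R => h (insert q (R.erase p))) w
  set C := mlext (fun R => h ((insert p R).erase q)) w
  set D := mlext (fun R => h ((R.erase p).erase q)) w
  rw [show 1 - δq / (δp + δq) = δp / (δp + δq) by field_simp; ring]
  rw [← sub_nonneg]
  have : 0 ≤ δp * δq * (B + C - A - D) := mul_nonneg (by positivity) (by linarith)
  refine this.trans (le_of_eq ?_)
  field_simp
  ring

/-- The fractional coordinates in `Q`. -/
def fractional (Q : Finset P) (y : P → ℝ) : Finset P := by
  classical exact Q.filter fun p => y p ∈ Set.Ioo (0 : ℝ) 1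

theorem mem_fractional {Q : Finset P} {y : P → ℝ} {p : P} :
    p ∈ fractional Q y ↔ p ∈ Q ∧ y p ∈ Set.Ioo (0 : ℝ) 1 := by
  simp [fractional]

theorem exists_isFractionalPair {Q : Finset P} {y : P → ℝ} (h : 1 < (fractional Q y).card) :
    ∃ a, IsFractionalPair Q y a := by
  obtain ⟨p, hp, q, hq, hpq⟩ := Finset.one_lt_card.1 h
  rw [mem_fractional] at hp hq
  exact ⟨(p, q), hp.1, hq.1, hpq, hp.2, hq.2⟩

/-- The invariants of the rounding after `τ` steps from `x`. -/
structure PipageInvariant (Q : Finset P) (x : P → ℝ) (τ : ℕ) (y : P → ℝ) : Prop where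
  mem_Icc : ∀ p ∈ Q, y p ∈ Set.Icc (0 : ℝ) 1
  sum_eq : ∑ p ∈ Q, y p = ∑ p ∈ Q, x p
  card_le : (fractional Q y).card ≤ 1 ∨ (fractional Q y).card + τ ≤ Q.card

theorem PipageInvariant.exchange {Q : Finset P} {x : P → ℝ} {τ : ℕ} {y y' : P → ℝ}
    (hy : PipageInvariant Q x τ y) {a : P × P} (ha : IsFractionalPair Q y a)
    (hy' : y' ∈ (exchange y a.1 a.2).support) : PipageInvariant Q x (τ + 1) y' := by
  obtain ⟨p, q⟩ := a
  obtain ⟨hp, hq, hpq, hyp, hyq⟩ := ha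
  dsimp only at hp hq hpq hyp hyq hy'
  obtain ⟨u, v, rfl, hu, hv, huv, hex⟩ := exists_of_mem_support_exchange hyp hyq hpq hy'
  set y' := Function.update (Function.update y p u) q v with hy'_def
  have ep : y' p = u := by simp [hy'_def, hpq]
  have eq : y' q = v := by simp [hy'_def]
  have er : ∀ r, r ≠ p → r ≠ q → y' r = y r := fun r h1 h2 => by simp [hy'_def, h1, h2]
  refine ⟨fun r hr => ?_, ?_, ?_⟩
  · by_cases h1 : r = p
    · rw [h1, ep]; exact hu
    · by_cases h2 : r = q
      · rw [h2, eq]; exact hv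
      · rw [er r h1 h2]; exact hy.mem_Icc r hr
  · rw [← hy.sum_eq]
    have hq' : q ∈ Q.erase p := Finset.mem_erase.2 ⟨hpq.symm, hq⟩
    rw [← Finset.add_sum_erase _ _ hp, ← Finset.add_sum_erase _ _ hq',
      ← Finset.add_sum_erase _ y hp, ← Finset.add_sum_erase _ y hq', ep, eq,
      Finset.sum_congr rfl fun r hr => er r (by grind) (by grind)]
    linarith
  · have hlt : (fractional Q y').card < (fractional Q y).card := by
      apply Finset.card_lt_card
      rw [Finset.ssubset_iff_of_subset]
      · rcases hex with h | h
        · exact ⟨p, mem_fractional.2 ⟨hp, hyp⟩, fun h' => h (ep ▸ (mem_fractional.1 h').2)⟩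
        · exact ⟨q, mem_fractional.2 ⟨hq, hyq⟩, fun h' => h (eq ▸ (mem_fractional.1 h').2)⟩
      · intro r hr
        rw [mem_fractional] at hr ⊢
        refine ⟨hr.1, ?_⟩
        by_cases h1 : r = p
        · rw [h1]; exact hyp
        · by_cases h2 : r = q
          · rw [h2]; exact hyq
          · rw [← er r h1 h2]; exact hr.2
    rcases hy.card_le with h | h <;> omega

variable {Q : Finset P} {pick : ℕ → (P → ℝ) → PMF (P × P)}
  (hpick : ∀ τ y, (∃ a, IsFractionalPair Q y a) → ∀ a ∈ (pick τ y).support, IsFractionalPair Q y a)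
  {x : P → ℝ} (hx : ∀ p ∈ Q, x p ∈ Set.Icc (0 : ℝ) 1)

include hpick hx

theorem pipageInvariant_of_mem_support (τ : ℕ) :
    ∀ y ∈ (pipage Q pick x τ).support, PipageInvariant Q x τ y := by
  induction τ with
  | zero =>
    intro y hy
    rw [pipage, PMF.mem_support_pure_iff] at hy
    subst hy
    exact ⟨hx, rfl, Or.inr (Finset.card_le_card fun p hp => (mem_fractional.1 hp).1)⟩
  | succ τ ih =>
    intro y' hy'
    rw [pipage, PMF.mem_support_bind_iff] at hy'
    obtain ⟨y, hy, hy'⟩ := hy'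
    have hi := ih y hy
    rw [pipageStep] at hy'
    split_ifs at hy' with hex
    · rw [PMF.mem_support_bind_iff] at hy'
      obtain ⟨a, ha, hy'⟩ := hy'
      exact hi.exchange (hpick τ y hex a ha) hy'
    · rw [PMF.mem_support_pure_iff] at hy'
      subst hy'
      exact ⟨hi.mem_Icc, hi.sum_eq, Or.inl (not_lt.1 fun h => hex (exists_isFractionalPair h))⟩

theorem le_emean_pipage {h : Finset P → ℝ} (hsub : Submodular h) (hpos : ∀ R, 0 ≤ h R)
    (z : P → ℝ) (τ : ℕ) : ENNReal.ofReal (mlext h (Q.piecewise x z)) ≤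
      emean (pipage Q pick x τ) fun y => ENNReal.ofReal (mlext h (Q.piecewise y z)) := by
  induction τ with
  | zero => rw [pipage, emean_pure]
  | succ τ ih =>
    rw [pipage, emean_bind]
    refine ih.trans (emean_mono _ fun y hy => ?_)
    rw [pipageStep]
    split_ifs with hex
    · rw [emean_bind]
      nth_rw 1 [← emean_const (pick τ y) (ENNReal.ofReal (mlext h (Q.piecewise y z)))]
      refine emean_mono _ fun a ha => ?_
      obtain ⟨h1, h2, h3, h4, h5⟩ := hpick τ y hex a ha
      exact le_emean_exchange hsub hpos h1 h2 h3 h4 h5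
    · rw [emean_pure]

variable {m : ℕ} (hm : ∑ p ∈ Q, x p = m)

include hm

/-- After `|Q|` steps at most one coordinate is fractional; a single one would contradict the
integrality of the sum. -/
theorem eq_zero_or_one_of_mem_support_pipage {y : P → ℝ}
    (hy : y ∈ (pipage Q pick x Q.card).support) : ∀ p ∈ Q, y p = 0 ∨ y p = 1 := by
  have hi := pipageInvariant_of_mem_support hpick hx Q.card y hy
  have hint : ∀ p ∈ Q, p ∉ fractional Q y → ∃ n : ℤ, y p = n := by
    intro p hp hpf
    obtain ⟨h0, h1⟩ := hi.mem_Icc p hp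
    rcases h0.eq_or_lt with h | h
    · exact ⟨0, by simp [← h]⟩
    · rcases h1.eq_or_lt with h' | h'
      · exact ⟨1, by simp [h']⟩
      · exact absurd (mem_fractional.2 ⟨hp, h, h'⟩) hpf
  have hempty : fractional Q y = ∅ := by
    by_contra hne
    have hone : (fractional Q y).card = 1 := by
      have := Finset.card_pos.2 (Finset.nonempty_iff_ne_empty.2 hne)
      rcases hi.card_le with h | h <;> omega
    obtain ⟨p, hp⟩ := Finset.card_eq_one.1 hone
    have hpm := mem_fractional.1 (hp ▸ Finset.mem_singleton_self p : p ∈ fractional Q y)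
    have hn : ∀ q ∈ Q.erase p, ∃ n : ℤ, y q = n := fun q hq => by
      rw [Finset.mem_erase] at hq
      exact hint q hq.2 (by rw [hp]; simpa using hq.1)
    choose! n hn using hn
    have hs := hi.sum_eq
    rw [hm, ← Finset.add_sum_erase _ _ hpm.1, Finset.sum_congr rfl hn, ← Int.cast_sum] at hs
    obtain ⟨h0, h1⟩ := hpm.2
    have e : y p = ((m - ∑ q ∈ Q.erase p, n q : ℤ) : ℝ) := by push_cast at hs ⊢; linarith
    rw [e] at h0 h1
    norm_cast at h0 h1
    omega
  intro p hp
  obtain ⟨h0, h1⟩ := hi.mem_Icc p hp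
  have hpf : p ∉ fractional Q y := by simp [hempty]
  rcases h0.eq_or_lt with h | h
  · exact Or.inl h.symm
  · rcases h1.eq_or_lt with h' | h'
    · exact Or.inr h'
    · exact absurd (mem_fractional.2 ⟨hp, h, h'⟩) hpf

theorem subset_and_card_of_mem_support_roundAgent {R : Finset P}
    (hR : R ∈ (roundAgent Q pick x).support) : R ⊆ Q ∧ R.card = m := by
  rw [roundAgent, PMF.mem_support_map_iff] at hR
  obtain ⟨y, hy, rfl⟩ := hR
  refine ⟨Finset.filter_subset _ _, ?_⟩
  have h01 := eq_zero_or_one_of_mem_support_pipage hpick hx hm hy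
  have hs := (pipageInvariant_of_mem_support hpick hx Q.card y hy).sum_eq
  rw [hm] at hs
  have : ∑ p ∈ Q, y p = ∑ p ∈ Q, if y p = 1 then (1 : ℝ) else 0 :=
    Finset.sum_congr rfl fun p hp => by rcases h01 p hp with h | h <;> simp [h]
  rw [this, ← Finset.sum_filter, Finset.sum_const, nsmul_eq_mul, mul_one] at hs
  convert Nat.cast_injective hs

/-- Once the block `Q` is integral, the random set agrees there with the rounded set. Writing that
set explicitly makes the function independent of the coordinates in `Q`, so these can be reset to
`z`. -/
theorem mlext_le_mean_roundAgent {h : Finset P → ℝ} (hsub : Submodular h) (hpos : ∀ R, 0 ≤ h R)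
    {z : P → ℝ} (hz : InCube z) (hxz : ∀ p ∈ Q, z p = x p) :
    mlext h z ≤ mean (roundAgent Q pick x) fun R => mlext (fun S => h (R ∪ S \ Q)) z := by
  rw [← ENNReal.ofReal_le_ofReal_iff (mean_nonneg _ fun _ _ => mlext_nonneg _ fun _ => hpos _),
    ← emean_ofReal _ fun _ => mlext_nonneg _ fun _ => hpos _, roundAgent, emean_map]
  have hxz' : Q.piecewise x z = z := by
    ext p
    by_cases hp : p ∈ Q <;> simp [hp, hxz]
  have h1 := le_emean_pipage hpick hx hsub hpos z Q.card
  rw [hxz'] at h1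
  refine h1.trans (emean_mono _ fun y hy => ENNReal.ofReal_le_ofReal (le_of_eq ?_))
  have h01 := eq_zero_or_one_of_mem_support_pipage hpick hx hm hy
  have hcube : InCube (Q.piecewise y z) := by
    intro p
    by_cases hp : p ∈ Q
    · rcases h01 p hp with h | h <;> simp [hp, h]
    · simpa [hp] using hz p
  calc mlext h (Q.piecewise y z)
      = mlext (fun S => h ((Q.filter fun p => y p = 1) ∪ S \ Q)) (Q.piecewise y z) := by
        refine mean_congr _ fun S hS => ?_
        congr 1
        ext p
        have hs := mem_support_randomSet hS p
        by_cases hp : p ∈ Q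
        · rw [Finset.piecewise_eq_of_mem _ _ _ hp] at hs
          rcases h01 p hp with h | h
          · simp [hp, hs.2 h, h]
          · simp [hp, hs.1 h, h]
        · simp [hp]
    _ = mlext (fun S => h ((Q.filter fun p => y p = 1) ∪ S \ Q)) z := by
        refine mlext_congr hcube hz fun q => ?_
        by_cases hq : q ∈ Q
        · right
          intro R
          congr 2
          grind
        · left; simp [hq]
    _ = _ := by
        congr!

end Rounding

/-! ### Rounding of all agents -/

section RoundState

variable {A P : Type*} [Fintype A] [DecidableEq A] [Fintype P] [DecidableEq P]

theorem Submodular.union_sdiff {f : Finset P → ℝ} (hsub : Submodular f) (C D : Finset P) :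
    Submodular fun S => f (C ∪ S \ D) := by
  intro S₁ S₂ hS p hp
  simp only [marginal]
  by_cases hpD : p ∈ C ∪ D
  · have : ∀ S : Finset P, C ∪ insert p S \ D = C ∪ S \ D := by grind
    simp [this]
  · have : ∀ S : Finset P, C ∪ insert p S \ D = insert p (C ∪ S \ D) := by grind
    rw [this, this]
    exact hsub _ _ (by grind) p (by grind)

variable {strat : A → Finset P} (hdisj : ∀ i j, i ≠ j → Disjoint (strat i) (strat j))
  {pick : ℕ → A → (P → ℝ) → PMF (P × P)} (hpick : IsPairRule strat pick)
  {x : A → P → ℝ} (hx : ∀ i, ∀ p ∈ strat i, x i p ∈ Set.Icc (0 : ℝ) 1)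
  {κ : A → ℕ} (hκ : ∀ i, ∑ p ∈ strat i, x i p = κ i)

include hdisj hpick hx hκ

theorem admissible_of_mem_support_roundState {R : Finset P}
    (hR : R ∈ (roundState strat pick x).support) : Admissible strat κ R := by
  rw [roundState, PMF.mem_support_map_iff] at hR
  obtain ⟨ω, hω, rfl⟩ := hR
  rw [mem_support_indep] at hω
  have hr := fun i => subset_and_card_of_mem_support_roundAgent
    (fun τ y h => hpick τ i y h) (hx i) (hκ i) (hω i)
  intro i
  rw [← (hr i).2]
  refine Finset.card_le_card fun p hp => ?_
  simp only [Finset.mem_inter, Finset.mem_biUnion, Finset.mem_univ, true_and] at hp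
  obtain ⟨⟨j, hj⟩, hi⟩ := hp
  by_cases hij : i = j
  · rwa [hij]
  · exact absurd ((hr j).1 hj) (Finset.disjoint_left.1 (hdisj i j hij) hi)

/-- A hybrid argument: the blocks of `s` are rounded, the others still sampled from `z`. To add
agent `i`, resample it given the others and apply the one-agent bound to `f` with the finished
blocks frozen, which is still submodular. -/
theorem mlext_le_expect_roundState (hcover : ∀ p, ∃ i, p ∈ strat i) {f : Finset P → ℝ}
    (hsub : Submodular f) (hpos : ∀ R, 0 ≤ f R) {z : P → ℝ} (hz : InCube z)
    (hxz : ∀ i, ∀ p ∈ strat i, z p = x i p) :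
    mlext f z ≤ expect (roundState strat pick x) f := by
  set μ : A → PMF (Finset P) := fun i => roundAgent (strat i) (fun τ => pick τ i) (x i) with hμ
  have hr : ∀ i, ∀ R ∈ (μ i).support, R ⊆ strat i := fun i R hR =>
    (subset_and_card_of_mem_support_roundAgent (fun τ y h => hpick τ i y h) (hx i) (hκ i) hR).1
  have key : ∀ s : Finset A, mlext f z ≤ mean (indep μ) fun ω =>
      mlext (fun S => f (s.biUnion ω ∪ S \ s.biUnion strat)) z := by
    intro s
    induction s using Finset.induction_on with
    | empty => simp [mean_const]
    | insert i s hi ih =>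
      refine ih.trans ?_
      have hup := mean_indep_update μ i (μ i) fun ω =>
        mlext (fun S => f ((insert i s).biUnion ω ∪ S \ (insert i s).biUnion strat)) z
      rw [Function.update_eq_self] at hup
      rw [← hup]
      refine mean_mono _ fun ω hω => ?_
      rw [mem_support_indep] at hω
      refine (mlext_le_mean_roundAgent (fun τ y h => hpick τ i y h) (hx i) (hκ i)
        (hsub.union_sdiff (s.biUnion ω) (s.biUnion strat)) (fun _ => hpos _) hz
        (hxz i)).trans (le_of_eq ?_)
      refine mean_congr _ fun R hR => ?_
      have hRi := hr i R hR
      congr 1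
      ext S
      congr 1
      have e1 : (insert i s).biUnion (Function.update ω i R) = R ∪ s.biUnion ω := by
        rw [Finset.biUnion_insert, Function.update_self]
        congr 1
        exact Finset.biUnion_congr rfl fun j hj => Function.update_of_ne (by grind) _ _
      have hRs : Disjoint R (s.biUnion strat) := by
        rw [Finset.disjoint_biUnion_right]
        exact fun j hj => (hdisj i j (by grind)).mono_left hRi
      rw [e1, Finset.biUnion_insert, Finset.union_sdiff_distrib, Finset.sdiff_eq_self_of_disjoint hRs]
      grind
  refine (key Finset.univ).trans (le_of_eq ?_)
  rw [roundState]
  refine Eq.trans ?_ (mean_map _ _ _).symm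
  refine mean_congr _ fun ω _ => ?_
  have : Finset.univ.biUnion strat = Finset.univ := by
    ext p; simpa using hcover p
  simp only [this, Finset.sdiff_eq_empty_iff_subset.2 (Finset.subset_univ _), Finset.union_empty]
  exact mlext_const _ z

end RoundState

/-! ### Selection and max-consensus -/

/-- The least weight on `S \ U` dominates all weights on `U \ S`, which has no more elements.
Nonnegativity matters when `U` is the smaller set. -/
theorem IsTopSet.sum_le_sum {P : Type*} [DecidableEq P] {Q : Finset P} {w : P → ℝ} {k : ℕ}
    {S U : Finset P} (hS : IsTopSet Q w k S) (hU : U ⊆ Q) (hUk : U.card ≤ k)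
    (hw : ∀ p ∈ Q, 0 ≤ w p) : ∑ p ∈ U, w p ≤ ∑ p ∈ S, w p := by
  obtain ⟨hSQ, hSk, htop⟩ := hS
  have hcard : (U \ S).card ≤ (S \ U).card := by
    rw [Finset.card_sdiff_le_card_sdiff_iff]
    exact hUk.trans hSk.ge
  have hdiff : ∑ p ∈ U \ S, w p ≤ ∑ p ∈ S \ U, w p := by
    rcases (S \ U).eq_empty_or_nonempty with he | hne
    · rw [he, Finset.card_empty, Nat.le_zero, Finset.card_eq_zero] at hcard
      rw [he, hcard]
    · obtain ⟨m, hm, hmin⟩ := Finset.exists_min_image (S \ U) w hne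
      rw [Finset.mem_sdiff] at hm
      calc ∑ p ∈ U \ S, w p ≤ (U \ S).card • w m :=
            Finset.sum_le_card_nsmul _ _ _ fun p hp => by
              rw [Finset.mem_sdiff] at hp
              exact htop m hm.1 p (hU hp.1) hp.2
        _ ≤ (S \ U).card • w m := nsmul_le_nsmul_left (hw m (hSQ hm.1)) hcard
        _ ≤ ∑ p ∈ S \ U, w p := Finset.card_nsmul_le_sum _ _ _ hmin
  have h1 := Finset.sum_sdiff_eq_sub (f := w) (Finset.inter_subset_left (s₁ := S) (s₂ := U))
  have h2 := Finset.sum_sdiff_eq_sub (f := w) (Finset.inter_subset_left (s₁ := U) (s₂ := S))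
  rw [Finset.sdiff_inter_self_left] at h1 h2
  rw [Finset.inter_comm] at h2
  linarith

/-! ### Invariants of the consensus and the progress of one iteration -/

section State

variable {A P : Type*} [Fintype A] [DecidableEq A] [Fintype P] [DecidableEq P]

theorem le_maxConsensus (G : SimpleGraph A) (y : A → P → ℝ) {i j : A} (h : j = i ∨ G.Adj i j)
    (p : P) : y j p ≤ maxConsensus G y i p :=
  Finset.le_sup' (fun j => y j p) (by simpa [closedNeighbors] using h)

theorem maxConsensus_le (G : SimpleGraph A) {y : A → P → ℝ} {p : P} {b : ℝ}
    (h : ∀ j, y j p ≤ b) (i : A) : maxConsensus G y i p ≤ b :=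
  Finset.sup'_le _ _ fun j _ => h j

/-- The invariants of the sampling phase after `t` iterations. -/
structure StateInvariant (G : SimpleGraph A) (strat : A → Finset P) (κ : A → ℕ) (T t : ℕ)
    (x : A → P → ℝ) : Prop where
  nonneg : ∀ i p, 0 ≤ x i p
  le_owner : ∀ j, ∀ p ∈ strat j, ∀ i, x i p ≤ x j p
  owner_le : ∀ j, ∀ p ∈ strat j, x j p ≤ t / T
  sum_eq : ∀ j, ∑ p ∈ strat j, x j p = t * κ j / T
  lag_le : ∀ i j, ∑ p ∈ strat j, (x j p - x i p) ≤ κ j * G.dist i j / T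

/-- The vector in which every strategy has the value known to its owner. -/
def combined (own : P → A) (x : A → P → ℝ) : P → ℝ := fun p => x (own p) p

variable {G : SimpleGraph A} {strat : A → Finset P} {κ : A → ℕ} {T t : ℕ}

theorem stateInvariant_zero (G : SimpleGraph A) (strat : A → Finset P) (κ : A → ℕ) (T : ℕ) :
    StateInvariant G strat κ T 0 fun _ _ => 0 where
  nonneg _ _ := le_rfl
  le_owner _ _ _ _ := le_rfl
  owner_le _ _ _ := by simp
  sum_eq _ := by simp
  lag_le _ _ := by simp only [sub_self, Finset.sum_const_zero]; positivity

variable {own : P → A} (hown : ∀ p i, p ∈ strat i ↔ own p = i)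

include hown

theorem sum_sum_inter (U : Finset P) (g : P → ℝ) :
    ∑ i, ∑ p ∈ U ∩ strat i, g p = ∑ p ∈ U, g p := by
  rw [← Finset.sum_fiberwise U own g]
  refine Finset.sum_congr rfl fun i _ => Finset.sum_congr ?_ fun _ _ => rfl
  ext p
  simp [hown]

theorem inter_biUnion {S : A → Finset P} (hS : ∀ i, S i ⊆ strat i) (i : A) :
    Finset.univ.biUnion S ∩ strat i = S i := by
  ext p
  simp only [Finset.mem_inter, Finset.mem_biUnion, Finset.mem_univ, true_and]
  refine ⟨fun ⟨⟨j, hj⟩, hi⟩ => ?_, fun h => ⟨⟨i, h⟩, hS i h⟩⟩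
  rw [← (hown p i).1 hi, (hown p j).1 (hS j hj)]
  exact hj

section Step

variable {x : A → P → ℝ} (hx : StateInvariant G strat κ T t x) {S : A → Finset P}
  (hS : ∀ i, S i ⊆ strat i)

include hx hS

/-- Other agents select only within their own blocks, so at `p` they hold at most the owner's
previous value. -/
theorem maxConsensus_propagate_owner {j : A} {p : P} (hp : p ∈ strat j) :
    maxConsensus G (fun i => propagate T (x i) (S i)) j p = propagate T (x j) (S j) p := by
  refine le_antisymm (maxConsensus_le G (fun i => ?_) j)
    (le_maxConsensus G (fun i => propagate T (x i) (S i)) (Or.inl rfl) p)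
  have h := hx.le_owner j p hp i
  by_cases hij : i = j
  · rw [hij]
  · have hpi : p ∉ S i := fun h' => hij <| by
      rw [← (hown p i).1 (hS i h'), (hown p j).1 hp]
    have hT : (0 : ℝ) ≤ if p ∈ S j then 1 / (T : ℝ) else 0 := by split_ifs <;> positivity
    simp only [propagate, hpi, if_false]
    linarith

theorem combined_step : combined own (maxConsensus G fun i => propagate T (x i) (S i)) =
    fun p => combined own x p + if p ∈ Finset.univ.biUnion S then 1 / (T : ℝ) else 0 := by
  ext p
  have hp : p ∈ strat (own p) := (hown p _).2 rfl
  have h := inter_biUnion hown hS (own p)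
  have hmem : p ∈ Finset.univ.biUnion S ↔ p ∈ S (own p) := by
    rw [← h]; simp only [Finset.mem_inter, hp, and_true]
  rw [combined, maxConsensus_propagate_owner hown hx hS hp]
  simp only [propagate, combined, hmem]

theorem StateInvariant.step (hG : G.Connected) (hcard : ∀ i, (S i).card = κ i) :
    StateInvariant G strat κ T (t + 1) (maxConsensus G fun i => propagate T (x i) (S i)) := by
  have hle : ∀ i p, x i p ≤ propagate T (x i) (S i) p := fun i p => by
    rw [propagate, le_add_iff_nonneg_right]
    split_ifs <;> positivity
  have hsum : ∀ j, ∑ p ∈ strat j, (if p ∈ S j then 1 / (T : ℝ) else 0) = κ j / T := fun j => by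
    rw [← Finset.sum_filter, Finset.filter_mem_eq_inter, Finset.inter_eq_right.2 (hS j),
      Finset.sum_const, hcard, nsmul_eq_mul, mul_one_div]
  have howner := fun {j : A} {p : P} (hp : p ∈ strat j) =>
    maxConsensus_propagate_owner hown hx hS hp
  constructor
  · exact fun i p => (hx.nonneg i p).trans ((hle i p).trans
      (le_maxConsensus G (fun i => propagate T (x i) (S i)) (Or.inl rfl) p))
  · intro j p hp i
    refine maxConsensus_le G (fun l => ?_) i
    have h := maxConsensus_propagate_owner hown hx hS hp
    have hlp : propagate T (x l) (S l) p ≤ propagate T (x j) (S j) p := by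
      by_cases hlj : l = j
      · rw [hlj]
      · have hpl : p ∉ S l := fun h' => hlj <| by
          rw [← (hown p l).1 (hS l h'), (hown p j).1 hp]
        refine le_trans (le_of_eq ?_) ((hx.le_owner j p hp l).trans (hle j p))
        simp [propagate, hpl]
    rwa [h]
  · intro j p hp
    rw [howner hp, propagate]
    have h := hx.owner_le j p hp
    have : (if p ∈ S j then 1 / (T : ℝ) else 0) ≤ 1 / (T : ℝ) := by
      split_ifs
      · exact le_rfl
      · positivity
    push_cast
    rw [add_div]
    exact add_le_add h this
  · intro j
    rw [Finset.sum_congr rfl fun p hp => howner hp]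
    simp only [propagate]
    rw [Finset.sum_add_distrib, hx.sum_eq, hsum]
    push_cast
    ring
  · intro i j
    by_cases hij : i = j
    · subst hij; simp
    -- Let `l` follow `i` on a shortest path to `j`. The new value at `i` is at least the old one at
    -- `l`, so the new lag is at most the old lag of `l` plus the mass `κ j / T` just added by `j`.
    · obtain ⟨w, hw⟩ := hG.exists_walk_length_eq_dist i j
      cases w with
      | nil => exact absurd rfl hij
      | @cons _ l _ hadj w =>
        have hd : G.dist l j + 1 ≤ G.dist i j := by
          rw [← hw, SimpleGraph.Walk.length_cons]
          exact Nat.add_le_add_right (SimpleGraph.dist_le w) 1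
        calc ∑ p ∈ strat j, (maxConsensus G (fun i => propagate T (x i) (S i)) j p -
              maxConsensus G (fun i => propagate T (x i) (S i)) i p)
            ≤ ∑ p ∈ strat j, ((x j p - x l p) + if p ∈ S j then 1 / (T : ℝ) else 0) := by
              refine Finset.sum_le_sum fun p hp => ?_
              have h := (hle l p).trans
                (le_maxConsensus G (fun i => propagate T (x i) (S i)) (Or.inr hadj) p)
              rw [howner hp, propagate]
              linarith
          _ ≤ κ j * G.dist l j / T + κ j / T := by
              rw [Finset.sum_add_distrib, hsum]
              exact add_le_add_left (hx.lag_le l j) _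
          _ = κ j * ((G.dist l j + 1 : ℕ) : ℝ) / T := by push_cast; ring
          _ ≤ κ j * G.dist i j / T := by gcongr

end Step

variable {x : A → P → ℝ} (hx : StateInvariant G strat κ T t x)

include hx

theorem le_combined (i : A) : x i ≤ combined own x := fun p =>
  hx.le_owner (own p) p ((hown p _).2 rfl) i

theorem combined_le (p : P) : combined own x p ≤ t / T :=
  hx.owner_le (own p) p ((hown p _).2 rfl)

theorem inCube_combined (ht : t ≤ T) : InCube (combined own x) := fun p =>
  ⟨hx.nonneg _ _, (combined_le hown hx p).trans
    (div_le_one_of_le₀ (by exact_mod_cast ht) (Nat.cast_nonneg T))⟩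

theorem inCube_state (ht : t ≤ T) (i : A) : InCube (x i) := fun p =>
  ⟨hx.nonneg _ _, (le_combined hown hx i p).trans (inCube_combined hown hx ht p).2⟩

theorem sum_combined_sub_le (hG : G.Connected) (i : A) :
    ∑ p, (combined own x p - x i p) ≤ (∑ j, (κ j : ℝ)) * G.diam / T := by
  have : Nonempty A := ⟨i⟩
  rw [← sum_sum_inter hown Finset.univ, Finset.sum_mul, Finset.sum_div]
  refine Finset.sum_le_sum fun j _ => ?_
  rw [Finset.univ_inter]
  calc ∑ p ∈ strat j, (combined own x p - x i p) = ∑ p ∈ strat j, (x j p - x i p) :=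
        Finset.sum_congr rfl fun p hp => by rw [combined, (hown p j).1 hp]
    _ ≤ κ j * G.dist i j / T := hx.lag_le i j
    _ ≤ κ j * G.diam / T := by
        -- The natural-number diameter bounds distances only if the extended one is finite, as
        -- connectedness ensures.
        have : G.dist i j ≤ G.diam :=
          SimpleGraph.dist_le_diam (SimpleGraph.connected_iff_ediam_ne_top.1 hG)
        gcongr

/-- The three losses are due to sampling, to the lag and to the quadratic term. Sampling is charged
twice, on the selected set and on the optimum, hence `1 / 4 + 1 / 4`; the lag only once. -/
theorem mlext_combined_step_ge {f : Finset P → ℝ} (hnorm : Normalized f) (hmono : Monotone f)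
    (hsub : Submodular f) {Rstar : Finset P} (hadm : Admissible strat κ Rstar)
    (hsingle : ∀ p, f {p} ≤ f Rstar) (hG : G.Connected) (ht : t < T) {w : A → P → ℝ}
    (hw : ∀ i, ∀ p, 0 ≤ w i p)
    (hacc : ∀ i, ∀ p ∈ strat i, |w i p - grad f (x i) p| ≤ 1 / (4 * T) * f {p})
    {S : A → Finset P} (hS : ∀ i, IsTopSet (strat i) (w i) (κ i) (S i))
    {k : ℝ} (hk : k = ∑ i, (κ i : ℝ)) :
    (1 - curvature f / T) * mlext f (combined own x) +
      (f Rstar - (k / (2 * T) + curvature f * k ^ 2 * G.diam / T +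
        curvature f * k ^ 2 / (2 * T)) * f Rstar) / T ≤
      mlext f (combined own (maxConsensus G fun i => propagate T (x i) (S i))) := by
  have hT : (0 : ℝ) < T := by exact_mod_cast (Nat.zero_le t).trans_lt ht
  have hF := nonneg_of_monotone hnorm hmono Rstar
  have hc := (curvature_mem_Icc hmono).1
  have hk0 : 0 ≤ k := by rw [hk]; positivity
  have hSs : ∀ i, S i ⊆ strat i := fun i => (hS i).1
  set z := combined own x with hz
  set F := f Rstar
  set c := curvature f
  have hzc : InCube z := inCube_combined hown hx ht.le
  have hS_int : ∀ i, Finset.univ.biUnion S ∩ strat i = S i := inter_biUnion hown hSs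
  have hScard : ((Finset.univ.biUnion S).card : ℝ) = k := by
    rw [Finset.card_eq_sum_ones, Nat.cast_sum, Nat.cast_one,
      ← sum_sum_inter hown (Finset.univ.biUnion S), hk]
    refine Finset.sum_congr rfl fun i _ => ?_
    rw [hS_int i, Finset.sum_const, (hS i).2.1, nsmul_eq_mul, mul_one]
  have hagent : ∀ i, ∑ p ∈ Rstar ∩ strat i, grad f z p -
      κ i * (F / (2 * T) + c * F * (k * G.diam / T)) ≤ ∑ p ∈ S i, grad f z p := by
    intro i
    have hxi := inCube_state hown hx ht.le i
    have hle := le_combined hown hx i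
    have herr : ∀ p ∈ strat i, |w i p - grad f (x i) p| ≤ F / (4 * T) := fun p hp =>
      (hacc i p hp).trans (by
        rw [one_div, inv_mul_eq_div]
        have := hsingle p
        gcongr)
    -- On selected strategies the delayed gradient may overestimate the one at `z`.
    have h1 : ∀ p ∈ S i, w i p - (F / (4 * T) + c * F * (k * G.diam / T)) ≤ grad f z p := by
      intro p hp
      have e1 := (abs_le.1 (herr p (hSs i hp))).2
      have e2 := le_grad hnorm hmono hsub hxi hzc hle p
      have e3 : c * f {p} * ∑ q, (z q - x i q) ≤ c * F * (k * G.diam / T) := by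
        have e4 := sum_combined_sub_le hown hx hG i
        rw [← hk] at e4
        have e5 : 0 ≤ ∑ q, (z q - x i q) := Finset.sum_nonneg fun q _ => sub_nonneg.2 (hle q)
        have := hsingle p
        gcongr
      linarith
    -- On the optimum the lag helps, since `grad` is antitone and `x i ≤ z`.
    have h2 : ∀ p ∈ Rstar ∩ strat i, grad f z p - F / (4 * T) ≤ w i p := by
      intro p hp
      have e1 := (abs_le.1 (herr p (Finset.mem_inter.1 hp).2)).1
      have e2 := grad_anti hnorm hmono hsub hxi hzc hle p
      linarith
    have h3 := (hS i).sum_le_sum (U := Rstar ∩ strat i) Finset.inter_subset_right (hadm i)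
      fun p _ => hw i p
    have h1' := Finset.sum_le_sum h1
    have h2' := Finset.sum_le_sum h2
    rw [Finset.sum_sub_distrib, Finset.sum_const, nsmul_eq_mul] at h1' h2'
    rw [(hS i).2.1] at h1'
    have h4 : ((Rstar ∩ strat i).card : ℝ) * (F / (4 * T)) ≤ κ i * (F / (4 * T)) := by
      have : ((Rstar ∩ strat i).card : ℝ) ≤ κ i := by exact_mod_cast hadm i
      gcongr
    have h5 : F / (2 * T) = F / (4 * T) + F / (4 * T) := by field_simp; ring
    rw [h5]
    linarith
  have htotal : ∑ p ∈ Rstar, grad f z p - k * (F / (2 * T) + c * F * (k * G.diam / T)) ≤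
      ∑ p ∈ Finset.univ.biUnion S, grad f z p := by
    rw [← sum_sum_inter hown Rstar, ← sum_sum_inter hown (Finset.univ.biUnion S), hk,
      Finset.sum_mul, ← Finset.sum_sub_distrib, ← hk]
    refine Finset.sum_le_sum fun i _ => ?_
    rw [hS_int i]
    exact hagent i
  have hopt := sum_grad_ge hnorm hmono hsub Rstar z
  have hstep := mlext_add_indicator_ge hnorm hmono hsub hzc (ε := 1 / (T : ℝ)) (by positivity)
    hsingle (Finset.univ.biUnion S) fun p _ => by
      refine (add_le_add (combined_le hown hx p) (le_refl (1 / (T : ℝ)))).trans ?_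
      rw [← add_div]
      apply div_le_one_of_le₀ _ hT.le
      exact_mod_cast ht
  rw [combined_step hown hx hSs]
  refine le_trans ?_ hstep
  rw [hScard]
  have h6 := mul_le_mul_of_nonneg_left (htotal.trans' (sub_le_sub_right hopt _))
    (show (0 : ℝ) ≤ 1 / T by positivity)
  refine le_trans (le_of_eq ?_) (sub_le_sub_right (add_le_add le_rfl h6) _)
  field_simp
  ring

end State

/-! ### The sampling phase -/

section Sampling

variable {A P : Type*} [Fintype A] [DecidableEq A] [Fintype P] [DecidableEq P]
  {f : Finset P → ℝ}

theorem mean_ind_exists_le {α ι : Type*} [Fintype α] (μ : PMF α) (s : Finset ι)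
    (E : ι → α → Prop) :
    mean μ (fun a => ind (∃ i ∈ s, E i a)) ≤ ∑ i ∈ s, mean μ fun a => ind (E i a) := by
  rw [← mean_finset_sum]
  refine mean_mono _ fun a _ => ?_
  by_cases h : ∃ i ∈ s, E i a
  · obtain ⟨i, hi, hE⟩ := h
    rw [ind_of_true ⟨i, hi, hE⟩, ← ind_of_true hE]
    exact Finset.single_le_sum (f := fun i => ind (E i a)) (fun i _ => ind_nonneg _) hi
  · rw [ind_of_false h]
    exact Finset.sum_nonneg fun i _ => ind_nonneg _

theorem mean_ind_gradientEstimate_le (hnorm : Normalized f) (hmono : Monotone f)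
    (hsub : Submodular f) (x : P → ℝ) (p : P) {k T : ℕ} (hk : 0 < k) (hT : 0 < T) :
    mean (indep fun _ : Fin k => randomSet x)
        (fun R => ind (1 / (4 * T) * f {p} < |gradientEstimate f R p - grad f x p|))
      ≤ 2 * Real.exp (-(1 / (8 * (T : ℝ) ^ 2) * k)) := by
  have hT' : (0 : ℝ) < T := by exact_mod_cast hT
  have h := mean_ind_deviation_le (randomSet x) (nonneg_of_monotone hnorm hmono {p})
    (fun R => insert_sub_erase_mem_Icc hnorm hmono hsub p R) hk (ε := 1 / (4 * (T : ℝ)))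
    (by positivity)
  have he : 2 * (k : ℝ) * (1 / (4 * (T : ℝ))) ^ 2 = 1 / (8 * (T : ℝ) ^ 2) * k := by
    field_simp; ring
  rw [he] at h
  simp only [gradientEstimate, Finset.union_singleton, Finset.sdiff_singleton_eq_erase]
  exact h

variable {own : P → A} {strat : A → Finset P} (hown : ∀ p i, p ∈ strat i ↔ own p = i)

include hown

/-- Each strategy is judged only by its owner, so the union bound has one term per strategy. -/
theorem mean_ind_inaccurate_le (hnorm : Normalized f) (hmono : Monotone f) (hsub : Submodular f)
    (x : A → P → ℝ) {K : A → ℕ} (hK : ∀ i, 0 < K i) {T : ℕ} (hT : 0 < T) :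
    mean (indep fun i => indep fun _ : Fin (K i) => randomSet (x i))
        (fun R => ind (∃ p ∈ (Finset.univ : Finset P), 1 / (4 * T) * f {p} <
          |gradientEstimate f (R (own p)) p - grad f (x (own p)) p|))
      ≤ 2 * Fintype.card P * Real.exp (-(1 / (8 * (T : ℝ) ^ 2) * ((⨅ i, K i : ℕ) : ℝ))) := by
  refine (mean_ind_exists_le _ _ _).trans ?_
  refine (Finset.sum_le_card_nsmul _ _
    (2 * Real.exp (-(1 / (8 * (T : ℝ) ^ 2) * ((⨅ i, K i : ℕ) : ℝ)))) fun p _ => ?_).trans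
    (le_of_eq (by rw [nsmul_eq_mul, Finset.card_univ]; ring))
  refine (mean_indep_eval (fun i => indep fun _ : Fin (K i) => randomSet (x i)) (own p) fun R =>
    ind (1 / (4 * T) * f {p} < |gradientEstimate f R p - grad f (x (own p)) p|)).le.trans ?_
  refine (mean_ind_gradientEstimate_le hnorm hmono hsub (x (own p)) p (hK _) hT).trans ?_
  have : ((⨅ i, K i : ℕ) : ℝ) ≤ K (own p) := by exact_mod_cast ciInf_le (OrderBot.bddBelow _) _
  gcongr

end Sampling

/-! ### The recursion and the success probability over all iterations -/

section Guarantee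

variable {A P : Type*} [Fintype A] [DecidableEq A] [Fintype P] [DecidableEq P]
  {G : SimpleGraph A} {strat : A → Finset P} {κ : A → ℕ} {T : ℕ} {f : Finset P → ℝ} {K : A → ℕ}
  {sel : ℕ → A → (P → ℝ) → (P → ℝ) → PMF (Finset P)} {own : P → A}

theorem mem_support_iteration {t : ℕ} {x y : A → P → ℝ}
    (hy : y ∈ (iteration G f K T sel t x).support) :
    ∃ (R : ∀ i, Fin (K i) → Finset P) (S : A → Finset P),
      (∀ i, S i ∈ (sel t i (x i) (gradientEstimate f (R i))).support) ∧
      y = maxConsensus G fun i => propagate T (x i) (S i) := by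
  rw [iteration, PMF.mem_support_bind_iff] at hy
  obtain ⟨R, -, hy⟩ := hy
  rw [PMF.mem_support_map_iff] at hy
  obtain ⟨S, hS, rfl⟩ := hy
  exact ⟨R, S, mem_support_indep.1 hS, rfl⟩

theorem stateInvariant_of_mem_support (hown : ∀ p i, p ∈ strat i ↔ own p = i) (hG : G.Connected)
    (hsel : IsSelectionRule strat κ sel) (t : ℕ) :
    ∀ x ∈ (stateAfter G f K T sel t).support, StateInvariant G strat κ T t x := by
  induction t with
  | zero =>
    intro x hx
    rw [stateAfter, PMF.mem_support_pure_iff] at hx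
    subst hx
    exact stateInvariant_zero G strat κ T
  | succ t ih =>
    intro y hy
    rw [stateAfter, PMF.mem_support_bind_iff] at hy
    obtain ⟨x, hx, hy⟩ := hy
    obtain ⟨R, S, hS, rfl⟩ := mem_support_iteration hy
    have hS := fun i => hsel _ _ _ _ _ (hS i)
    exact (ih x hx).step hown (fun i => (hS i).1) hG fun i => (hS i).2.1

/-- The lower bound for the value of the multilinear extension after `t` iterations. -/
def progressBound (c B : ℝ) (T t : ℕ) : ℝ := B / T * ∑ s ∈ Finset.range t, (1 - c / T) ^ s

theorem progressBound_succ (c B : ℝ) (T t : ℕ) :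
    progressBound c B T (t + 1) = (1 - c / T) * progressBound c B T t + B / T := by
  rw [progressBound, progressBound, geom_sum_succ]
  ring

/-- For `c > 0` the geometric sum is `(1 - (1 - c/T)^T) * (T / c)`, and `(1 - c/T)^T ≤ e^{-c}` as `c
≤ 1 ≤ T`; for `c = 0` equality holds. -/
theorem curvatureFactor_mul_le_progressBound {c B : ℝ} (hc : c ∈ Set.Icc (0 : ℝ) 1) (hB : 0 ≤ B)
    {T : ℕ} (hT : 0 < T) : curvatureFactor c * B ≤ progressBound c B T T := by
  have hT' : (0 : ℝ) < T := by exact_mod_cast hT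
  rw [curvatureFactor, progressBound]
  split_ifs with h0
  · subst h0
    simp only [zero_div, sub_zero, one_pow, Finset.sum_const, Finset.card_range, nsmul_eq_mul,
      mul_one]
    rw [div_mul_cancel₀ _ hT'.ne', one_mul]
  · have hc0 : 0 < c := lt_of_le_of_ne hc.1 (Ne.symm h0)
    have hgeom : ∑ s ∈ Finset.range T, (1 - c / T) ^ s = (1 - (1 - c / T) ^ T) * (T / c) := by
      have h := geom_sum_mul (1 - c / (T : ℝ)) T
      have e : (1 - c / (T : ℝ)) - 1 = -(c / T) := by ring
      rw [e] at h
      have hcT : c / (T : ℝ) ≠ 0 := by positivity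
      rw [← inv_div c, eq_mul_inv_iff_mul_eq₀ hcT]
      linarith
    have hexp := Real.one_sub_div_pow_le_exp_neg (n := T) (t := c)
      (hc.2.trans (by exact_mod_cast hT))
    rw [hgeom]
    calc 1 / c * (1 - Real.exp (-c)) * B = B / c * (1 - Real.exp (-c)) := by ring
      _ ≤ B / c * (1 - (1 - c / T) ^ T) := by gcongr
      _ = B / T * ((1 - (1 - c / T) ^ T) * (T / c)) := by field_simp

theorem curvatureFactor_nonneg {c : ℝ} (hc : 0 ≤ c) : 0 ≤ curvatureFactor c := by
  rw [curvatureFactor]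
  split_ifs
  · exact zero_le_one
  · have : Real.exp (-c) ≤ 1 := Real.exp_le_one_iff.2 (by linarith)
    exact mul_nonneg (by positivity) (by linarith)

/-- Accurate estimates lead into `good` for every tie-breaking, so failure requires some inaccurate
estimate. -/
theorem emean_iteration_le (hown : ∀ p i, p ∈ strat i ↔ own p = i) (hnorm : Normalized f)
    (hmono : Monotone f) (hsub : Submodular f) (hK : ∀ i, 0 < K i) (hT : 0 < T) {t : ℕ}
    {x : A → P → ℝ} {good : Set (A → P → ℝ)}
    (hgood : ∀ (w : A → P → ℝ) (S : A → Finset P), (∀ i p, 0 ≤ w i p) →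
      (∀ i, ∀ p ∈ strat i, |w i p - grad f (x i) p| ≤ 1 / (4 * T) * f {p}) →
      (∀ i, S i ∈ (sel t i (x i) (w i)).support) →
      (maxConsensus G fun i => propagate T (x i) (S i)) ∈ good) :
    (iteration G f K T sel t x).toOuterMeasure goodᶜ ≤
      ENNReal.ofReal (2 * Fintype.card P *
        Real.exp (-(1 / (8 * (T : ℝ) ^ 2) * ((⨅ i, K i : ℕ) : ℝ)))) := by
  rw [toOuterMeasure_eq_emean, iteration, emean_bind]
  refine le_trans ?_ (ENNReal.ofReal_le_ofReal
    (mean_ind_inaccurate_le hown hnorm hmono hsub x hK hT))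
  rw [← emean_ofReal _ fun _ => ind_nonneg _]
  refine emean_mono _ fun R _ => ?_
  rw [emean_map]
  by_cases hbad : ∃ p ∈ (Finset.univ : Finset P), 1 / (4 * T) * f {p} <
      |gradientEstimate f (R (own p)) p - grad f (x (own p)) p|
  · rw [ind_of_true hbad, ENNReal.ofReal_one]
    refine (emean_mono _ fun S _ => ?_).trans (emean_const _ 1).le
    exact Set.indicator_le_self' (fun _ _ => zero_le) _
  · rw [ind_of_false hbad, ENNReal.ofReal_zero]
    refine (emean_mono _ fun S hS => ?_).trans (emean_const _ 0).le
    push Not at hbad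
    have hmem := hgood (fun i => gradientEstimate f (R i)) S (fun i p => ?_) (fun i p hp => ?_)
      (mem_support_indep.1 hS)
    · simp only [Function.comp_apply]
      rw [Set.indicator_of_notMem (by simpa using hmem)]
    · rw [gradientEstimate]
      refine div_nonneg (Finset.sum_nonneg fun l _ => sub_nonneg.2 (hmono ?_)) (Nat.cast_nonneg _)
      exact Finset.sdiff_subset.trans Finset.subset_union_left
    · have h := hbad p (Finset.mem_univ p)
      rwa [(hown p i).1 hp] at h

/-- The union bound over the iterations. -/
theorem toOuterMeasure_stateAfter_compl_le {good : ℕ → Set (A → P → ℝ)}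
    (h0 : (fun _ _ => 0) ∈ good 0) {δ : ℝ≥0∞} {n : ℕ}
    (hstep : ∀ t < n, ∀ x ∈ good t,
      (iteration G f K T sel t x).toOuterMeasure (good (t + 1))ᶜ ≤ δ) :
    (stateAfter G f K T sel n).toOuterMeasure (good n)ᶜ ≤ n * δ := by
  induction n with
  | zero =>
    rw [stateAfter, PMF.toOuterMeasure_pure_apply, if_neg (by simpa using h0)]
    exact zero_le
  | succ n ih =>
    have ih := ih fun t ht => hstep t (ht.trans n.lt_succ_self)
    rw [stateAfter, PMF.toOuterMeasure_bind_apply]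
    rw [toOuterMeasure_eq_emean] at ih
    push_cast
    rw [add_mul, one_mul]
    refine le_trans ?_ (add_le_add ih (emean_const (stateAfter G f K T sel n) δ).le)
    rw [← emean_add]
    refine emean_mono _ fun x _ => ?_
    by_cases hx : x ∈ good n
    · rw [Set.indicator_of_notMem (by simpa using hx), zero_add]
      exact hstep n n.lt_succ_self x hx
    · rw [Set.indicator_of_mem (by simpa using hx)]
      refine le_trans ?_ le_self_add
      rw [toOuterMeasure_eq_emean]
      refine (emean_mono _ fun y _ => ?_).trans (emean_const _ 1).le
      exact Set.indicator_le_self' (fun _ _ => zero_le) _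

theorem one_sub_le_toOuterMeasure {α : Type*} (μ : PMF α) {s : Set α} {δ : ℝ} (hδ : 0 ≤ δ)
    (h : μ.toOuterMeasure sᶜ ≤ ENNReal.ofReal δ) :
    ENNReal.ofReal (1 - δ) ≤ μ.toOuterMeasure s := by
  rw [ENNReal.ofReal_sub _ hδ, ENNReal.ofReal_one, tsub_le_iff_right]
  refine le_trans (le_of_eq ?_) (add_le_add le_rfl h)
  rw [toOuterMeasure_eq_emean, toOuterMeasure_eq_emean, ← emean_add, ← emean_const μ 1]
  congr 1
  ext a
  by_cases ha : a ∈ s <;> simp [ha]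

end Guarantee

end

end DistSubmod

/-- Performance guarantee of the distributed algorithm: every output is admissible and, with
probability at least `1 - 2 T n e^{-K/(8T²)}` over the sampling phase, the expectation over the
rounding phase of the value of the output is at least the stated multiple of the optimum. -/
theorem mainTheorem1 {A P : Type*} [Fintype A] [DecidableEq A] [Fintype P] [DecidableEq P]
    (G : SimpleGraph A) (hG : G.Connected)
    (strat : A → Finset P)
    (hdisj : ∀ i j, i ≠ j → Disjoint (strat i) (strat j))
    (hcover : ∀ p, ∃ i, p ∈ strat i)
    (κ : A → ℕ) (hκ : ∀ i, 1 ≤ κ i ∧ κ i ≤ (strat i).card)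
    (f : Finset P → ℝ) (hnorm : DistSubmod.Normalized f) (hmono : Monotone f)
    (hsub : DistSubmod.Submodular f)
    (Rstar : Finset P) (hopt : DistSubmod.IsOptimal f strat κ Rstar)
    (T : ℕ) (hT : 0 < T) (K : A → ℕ) (hK : ∀ i, 0 < K i)
    (sel : ℕ → A → (P → ℝ) → (P → ℝ) → PMF (Finset P))
    (hsel : DistSubmod.IsSelectionRule strat κ sel)
    (pick : ℕ → A → (P → ℝ) → PMF (P × P))
    (hpick : DistSubmod.IsPairRule strat pick)
    (c : ℝ) (hc : c = DistSubmod.curvature f)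
    (k : ℝ) (hk : k = ∑ i, (κ i : ℝ)) :
    (∀ R ∈ (DistSubmod.algorithmOutput G f strat K T sel pick).support,
      DistSubmod.Admissible strat κ R) ∧
    ENNReal.ofReal (1 - 2 * (T : ℝ) * (Fintype.card P : ℝ) *
        Real.exp (-((1 / (8 * (T : ℝ) ^ 2)) * ((⨅ i, K i : ℕ) : ℝ)))) ≤
      (DistSubmod.stateAfter G f K T sel T).toOuterMeasure
        {x | DistSubmod.curvatureFactor c *
              (1 - (2 * c * k * (G.diam : ℝ) + c * k / 2 + 1) * (k / (T : ℝ))) * f Rstar ≤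
            DistSubmod.expect (DistSubmod.roundState strat pick x) f} := by
  open DistSubmod in
  have hT' : (0 : ℝ) < T := by exact_mod_cast hT
  choose own hown' using hcover
  have hown : ∀ p i, p ∈ strat i ↔ own p = i := fun p i =>
    ⟨fun h => by_contra fun hne => Finset.disjoint_left.1 (hdisj _ _ hne) (hown' p) h,
      fun h => h ▸ hown' p⟩
  have hblock : ∀ x, StateInvariant G strat κ T T x →
      (∀ i, ∀ p ∈ strat i, x i p ∈ Set.Icc (0 : ℝ) 1) ∧ ∀ i, ∑ p ∈ strat i, x i p = κ i :=
    fun x hx => ⟨fun i p _ => inCube_state hown hx le_rfl i p, fun i => by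
      rw [hx.sum_eq, mul_div_cancel_left₀ _ hT'.ne']⟩
  refine ⟨fun R hR => ?_, ?_⟩
  · rw [algorithmOutput, PMF.mem_support_bind_iff] at hR
    obtain ⟨x, hx, hR⟩ := hR
    obtain ⟨h1, h2⟩ := hblock x (stateInvariant_of_mem_support hown hG hsel T x hx)
    exact admissible_of_mem_support_roundState hdisj hpick h1 h2 hR
  · have hfpos := nonneg_of_monotone hnorm hmono
    have hcI := curvature_mem_Icc hmono
    have hk0 : 0 ≤ k := by rw [hk]; positivity
    -- Singletons are admissible because `1 ≤ κ i`.
    have hsingle : ∀ p, f {p} ≤ f Rstar := fun p => hopt.2 {p} fun i =>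
      (Finset.card_le_card Finset.inter_subset_left).trans
        ((Finset.card_singleton p).le.trans (hκ i).1)
    rw [← hc] at hcI
    set B : ℝ := f Rstar - (k / (2 * T) + c * k ^ 2 * G.diam / T + c * k ^ 2 / (2 * T)) * f Rstar
      with hB
    set good : ℕ → Set (A → P → ℝ) := fun t => {x | StateInvariant G strat κ T t x ∧
      progressBound c B T t ≤ mlext f (combined own x)} with hgood
    set δ : ℝ := 2 * Fintype.card P *
      Real.exp (-(1 / (8 * (T : ℝ) ^ 2) * ((⨅ i, K i : ℕ) : ℝ))) with hδ
    have hδ0 : 0 ≤ δ := by positivity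
    have hcompl : (stateAfter G f K T sel T).toOuterMeasure (good T)ᶜ ≤ ENNReal.ofReal (T * δ) := by
      rw [ENNReal.ofReal_mul hT'.le, ENNReal.ofReal_natCast]
      refine toOuterMeasure_stateAfter_compl_le ?_ fun t ht x hx => ?_
      · refine ⟨stateInvariant_zero G strat κ T, ?_⟩
        rw [progressBound, Finset.range_zero, Finset.sum_empty, mul_zero]
        exact mlext_nonneg _ hfpos
      · refine emean_iteration_le hown hnorm hmono hsub hK hT fun w S hw hacc hS => ?_
        have hS := fun i => hsel _ _ _ _ _ (hS i)
        refine ⟨hx.1.step hown (fun i => (hS i).1) hG fun i => (hS i).2.1, ?_⟩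
        refine le_trans ?_ (mlext_combined_step_ge hown hx.1 hnorm hmono hsub hopt.1 hsingle hG ht
          hw hacc hS hk)
        rw [progressBound_succ, ← hc]
        have : 0 ≤ 1 - c / T := sub_nonneg.2 <| div_le_one_of_le₀
          (hcI.2.trans (by exact_mod_cast hT)) hT'.le
        exact add_le_add (mul_le_mul_of_nonneg_left hx.2 this) le_rfl
    have hprob := one_sub_le_toOuterMeasure _ (by positivity) hcompl
    rw [show (1 : ℝ) - T * δ = 1 - 2 * T * Fintype.card P *
      Real.exp (-(1 / (8 * (T : ℝ) ^ 2) * ((⨅ i, K i : ℕ) : ℝ))) by rw [hδ]; ring] at hprob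
    refine hprob.trans (MeasureTheory.measure_mono fun x hx => ?_)
    obtain ⟨h1, h2⟩ := hblock x hx.1
    have hround := mlext_le_expect_roundState hdisj hpick h1 h2 (fun p => ⟨own p, hown' p⟩) hsub
      hfpos (inCube_combined hown hx.1 le_rfl) fun i p hp => by rw [combined, (hown p i).1 hp]
    have hle : (1 - (2 * c * k * (G.diam : ℝ) + c * k / 2 + 1) * (k / (T : ℝ))) * f Rstar ≤ B := by
      -- The stated constants for lag and sampling are twice those in `B`; this is the difference.
      have hslack : 0 ≤ (c * k * G.diam + 1 / 2) * (k / T) * f Rstar := by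
        have := hcI.1
        have := hfpos Rstar
        positivity
      have e : B - (1 - (2 * c * k * (G.diam : ℝ) + c * k / 2 + 1) * (k / (T : ℝ))) * f Rstar
          = (c * k * G.diam + 1 / 2) * (k / T) * f Rstar := by
        rw [hB]; field_simp; ring
      linarith
    change curvatureFactor c * _ * f Rstar ≤ _
    rw [mul_assoc]
    refine le_trans ?_ hround
    refine (mul_le_mul_of_nonneg_left hle (curvatureFactor_nonneg hcI.1)).trans ?_
    -- If `B ≤ 0` the claimed bound is nonpositive and holds trivially.
    rcases le_total 0 B with h | h
    · exact (curvatureFactor_mul_le_progressBound hcI h hT).trans hx.2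
    · exact (mul_nonpos_of_nonneg_of_nonpos (curvatureFactor_nonneg hcI.1) h).trans
        (mlext_nonneg _ hfpos)
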